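/- **Conventions.** Graphs are finite, and loops and multiple edges are allowed. A graph is trivalent if every vertex has exactly three half-edges, and the genus of a connected graph is its first Betti number $|E|-|V|+1$. An automorphism of a graph is a pair of compatible permutations of its vertices and of its half-edges (respecting the pairing of half-edges to edges). **Tropical Hurwitz numbers.** A tropical curve is a connected, finite, trivalent metric graph. Let $E=\mathbb{R}/\ell\mathbb{Z}$, $\ell>0$, be a tropical elliptic curve. A tropical cover $\pi:C\to E$ is a continuous non-constant map from a tropical curve that is affine with integer slope on each edge and balanced: the weight $w_e$ of an edge $e$ is the absolute value of the slope of $\pi|_e$, and at every vertex the weights of the adjacent rays that map to the left of its image add up to the same number as the weights of those that map to the right. Its degree is $\sum_{P\in\pi^{-1}(p)} w_{e_P}$ for any $p\in E$ that is not the image of a vertex, where $e_P$ is the edge that contains $P$; its branch points are the images of the vertices. An isomorphism of covers $\pi:C\to E$, $\pi':C'\to E$ is an isometry $\varphi:C\to C'$ with $\pi'\circ\varphi=\pi$. Let $g>1$ and fix pairwise distinct points $p_1,\dots,p_{2g-2}\in E$. Then $$N^{\mathrm{trop}}_{d,g}:=\sum_{\pi}\frac{1}{|\mathrm{Aut}(\pi)|}\prod_e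 w_e ,$$ where $\pi:C\to E$ runs over the isomorphism classes of tropical covers of degree $d$ whose source has genus $g$ and whose set of branch points is $\{p_1,\dots,p_{2g-2}\}$, and $e$ over the edges of $C$. **Feynman integrals.** Let $\tau$ be in the upper half-plane and $q=e^{\pi i\tau}$. The propagator is $$P(z,q)=\frac1{4\pi^2}\wp(z)+\frac1{12}E_2(q^2),\qquad E_2(q)=1-24\sum_{d\ge1}\sigma_1(d)q^d,$$ with $\wp$ the Weierstrass function of the lattice $\mathbb{Z}+\mathbb{Z}\tau$, where $\wp(0)$ is read as the finite part of $\wp$ at its pole $0$, which is $0$ (this concerns only edges that are loops). A Feynman graph of genus $g$ is a connected trivalent graph $\Gamma$ of genus $g$; label its vertices $x_1,\dots,x_{2g-2}$. For a total order $\Omega$ of the vertices choose real numbers $y_1,\dots,y_{2g-2}$ that are ordered as $\Omega$ says and small in the sense that $|y_i-y_j|<\operatorname{Im}\tau$ for all $i,j$. Let $\gamma_j:[0,1]\to\mathbb{C}$, $t\mapsto iy_j+t$, and set $$I_{\Gamma,\Omega}(q)=\int_{z_j\in\gamma_j}\ \prod_{e}\bigl(-P(z_{a(e)}-z_{b(e)},q)\bigr),\qquad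 I_\Gamma(q)=\sum_{\Omega}I_{\Gamma,\Omega}(q),$$ where $e$ runs over the edges of $\Gamma$, $x_{a(e)}$ and $x_{b(e)}$ are the ends of $e$, and $\Omega$ runs over all $(2g-2)!$ orders of the vertices. **Theorem (tropical curves and integrals).** Let $g>1$. There are only finitely many isomorphism classes of Feynman graphs of genus $g$, and for each $d$ only finitely many isomorphism classes of covers contribute to $N^{\mathrm{trop}}_{d,g}$. For every $\tau$ in the upper half-plane and $q=e^{\pi i\tau}$, for every $\ell>0$, every choice of pairwise distinct points $p_i$ and every choice of the $y_j$ as above, the series on the left converges and $$\sum_{d=1}^{\infty}N^{\mathrm{trop}}_{d,g}\,q^{2d}=\sum_{\Gamma}\frac{1}{|\mathrm{Aut}(\Gamma)|}\,I_\Gamma(q),$$ where $\Gamma$ runs over the isomorphism classes of Feynman graphs of genus $g$. -/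

import Mathlib

noncomputable section

namespace TropMirror

/-! ### Graphs -/

/-- A finite graph, loops and multiple edges allowed. Each edge `e` has the two half-edges
`(e, false)` and `(e, true)`, and `ends e b` is the vertex to which the half-edge `(e, b)` is
attached. (The names `false`, `true` only fix a reference direction of the edge; isomorphisms need
not respect it.) -/
structure Multigraph : Type 1 where
  V : Type
  E : Type
  fintypeV : Fintype V
  fintypeE : Fintype E
  ends : E → Bool → V

attribute [instance] Multigraph.fintypeV Multigraph.fintypeE

namespace Multigraph

/-- Two vertices are joined by an edge. -/
def Joined (G : Multigraph) (v w : G.V) : Prop :=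
  ∃ (e : G.E) (b : Bool), G.ends e b = v ∧ G.ends e (!b) = w

/-- `G` is nonempty and any two vertices are linked by a path. -/
def Connected (G : Multigraph) : Prop :=
  Nonempty G.V ∧ ∀ v w : G.V, Relation.ReflTransGen G.Joined v w

/-- Every vertex has exactly three half-edges (so a loop counts twice). -/
def Trivalent (G : Multigraph) : Prop :=
  ∀ v : G.V, Nat.card {x : G.E × Bool // G.ends x.1 x.2 = v} = 3

/-- The first Betti number of a connected graph. -/
def genus (G : Multigraph) : ℤ :=
  (Fintype.card G.E : ℤ) - Fintype.card G.V + 1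

/-- An isomorphism of graphs: compatible bijections of the vertices and of the half-edges, where
the half-edge `(e, b)` goes to `(edge e, b)` if `flip e = false` and to `(edge e, !b)` if
`flip e = true`. -/
@[ext]
structure Iso (G G' : Multigraph) where
  vert : G.V ≃ G'.V
  edge : G.E ≃ G'.E
  flip : G.E → Bool
  ends_eq : ∀ e b, G'.ends (edge e) (xor b (flip e)) = vert (G.ends e b)

/-- The identity. -/
def Iso.refl (G : Multigraph) : Iso G G where
  vert := Equiv.refl _
  edge := Equiv.refl _
  flip := fun _ => false
  ends_eq := by simp

/-- The inverse isomorphism. -/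
def Iso.symm {G G' : Multigraph} (φ : Iso G G') : Iso G' G where
  vert := φ.vert.symm
  edge := φ.edge.symm
  flip := fun e => φ.flip (φ.edge.symm e)
  ends_eq := fun e b => by
    rw [Equiv.eq_symm_apply, ← φ.ends_eq]
    simp

/-- The composition of isomorphisms. -/
def Iso.trans {G G' G'' : Multigraph} (φ : Iso G G') (ψ : Iso G' G'') : Iso G G'' where
  vert := φ.vert.trans ψ.vert
  edge := φ.edge.trans ψ.edge
  flip := fun e => xor (φ.flip e) (ψ.flip (φ.edge e))
  ends_eq := fun e b => by
    have h := ψ.ends_eq (φ.edge e) (xor b (φ.flip e))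
    rw [φ.ends_eq] at h
    simpa [Bool.xor_assoc] using h

end Multigraph

/-! ### Tropical curves and tropical covers -/

/-- A tropical curve: a connected, finite, trivalent metric graph. The edge `e` is the segment
`[0, length e]`, the end `0` being glued to `ends e false` and `length e` to `ends e true`. -/
structure TropicalCurve : Type 1 extends Multigraph where
  connected : toMultigraph.Connected
  trivalent : toMultigraph.Trivalent
  length : E → ℝ
  length_pos : ∀ e, 0 < length e

/-- The coordinate on the edge `φ e` of the image of the point with coordinate `t` on `e`, under
an isometry `φ`; here `len` is the length of `e`. -/
def flipCoord (flip : Bool) (len t : ℝ) : ℝ := if flip then len - t else t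

/-- An isometry of metric graphs: an isomorphism of the underlying (trivalent) graphs that
preserves the lengths; it maps each edge linearly. -/
@[ext]
structure CurveIso (C C' : TropicalCurve) extends
    Multigraph.Iso C.toMultigraph C'.toMultigraph where
  length_eq : ∀ e, C'.length (edge e) = C.length e

/-- The tropical elliptic curve of length `ℓ` is the circle `AddCircle ℓ = ℝ / ℓℤ`.

A map from a metric graph to it that is continuous and integer affine on each edge is given by the
images `vmap` of the vertices and the integers `slope e`, the slope on the edge `e` in the
direction from `ends e false` to `ends e true`; it is well defined and continuous by
`continuous_eq`. A tropical cover is such a map that is non-constant and balanced. -/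
structure PreCover (ℓ : ℝ) : Type 1 where
  C : TropicalCurve
  vmap : C.V → AddCircle ℓ
  slope : C.E → ℤ
  continuous_eq : ∀ e, vmap (C.ends e true) =
    vmap (C.ends e false) + ((slope e * C.length e : ℝ) : AddCircle ℓ)

namespace PreCover

variable {ℓ : ℝ}

/-- The image of the point with coordinate `t ∈ [0, length e]` of the edge `e`. -/
def edgeMap (π : PreCover ℓ) (e : π.C.E) (t : ℝ) : AddCircle ℓ :=
  π.vmap (π.C.ends e false) + ((π.slope e * t : ℝ) : AddCircle ℓ)

/-- The weight of an edge, i.e. the absolute value of the slope. -/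
def weight (π : PreCover ℓ) (e : π.C.E) : ℕ := (π.slope e).natAbs

/-- The slope along the ray that leaves the vertex `ends e b` through the half-edge `(e, b)`. The
ray maps to the right of the image of the vertex if this is positive, to the left if it is
negative. -/
def raySlope (π : PreCover ℓ) (e : π.C.E) (b : Bool) : ℤ :=
  if b then -π.slope e else π.slope e

open Classical in
/-- The balancing condition: at every vertex the weights of the rays that map to the left add up
to the same number as the weights of the rays that map to the right. -/
def Balanced (π : PreCover ℓ) : Prop :=
  ∀ v : π.C.V,
    ∑ x : π.C.E × Bool with π.C.ends x.1 x.2 = v ∧ π.raySlope x.1 x.2 < 0, π.weight x.1 =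
    ∑ x : π.C.E × Bool with π.C.ends x.1 x.2 = v ∧ 0 < π.raySlope x.1 x.2, π.weight x.1

/-- The map is not constant (the source being connected, not constant on some edge). -/
def NonConstant (π : PreCover ℓ) : Prop := ∃ e, π.slope e ≠ 0

/-- The weighted number of preimages of every point that is not the image of a vertex is `d`. -/
def HasDegree (π : PreCover ℓ) (d : ℕ) : Prop :=
  ∀ x : AddCircle ℓ, (∀ v, π.vmap v ≠ x) →
    ∑ e, Set.ncard {t : ℝ | t ∈ Set.Ioo 0 (π.C.length e) ∧ π.edgeMap e t = x} * π.weight e = d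

end PreCover

/-- A tropical cover of the tropical elliptic curve of length `ℓ`. -/
structure TropicalCover (ℓ : ℝ) : Type 1 extends PreCover ℓ where
  nonConstant : toPreCover.NonConstant
  balanced : toPreCover.Balanced

namespace TropicalCover

variable {ℓ : ℝ}

/-- An isomorphism of covers: an isometry `φ` of the source curves with `π' ∘ φ = π`. -/
@[ext]
structure Iso (π π' : TropicalCover ℓ) extends CurveIso π.C π'.C where
  map_eq : ∀ e, ∀ t ∈ Set.Icc 0 (π.C.length e),
    π'.edgeMap (edge e) (flipCoord (flip e) (π.C.length e) t) = π.edgeMap e t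

/-- The identity. -/
def Iso.refl (π : TropicalCover ℓ) : Iso π π where
  toIso := Multigraph.Iso.refl _
  length_eq := fun _ => rfl
  map_eq := fun _ _ _ => rfl

/-- The inverse isomorphism. -/
def Iso.symm {π π' : TropicalCover ℓ} (φ : Iso π π') : Iso π' π where
  toIso := φ.toIso.symm
  length_eq := fun e => by
    rw [← φ.length_eq]
    simp [Multigraph.Iso.symm]
  map_eq := fun e t ht => by
    obtain ⟨e, rfl⟩ := φ.edge.surjective e
    simp only [Multigraph.Iso.symm, Equiv.symm_apply_apply, φ.length_eq] at ht ⊢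
    have h : flipCoord (φ.flip e) (π.C.length e) t ∈ Set.Icc 0 (π.C.length e) := by
      unfold flipCoord
      split_ifs
      · exact ⟨by linarith [ht.2], by linarith [ht.1]⟩
      · exact ht
    rw [← φ.map_eq e _ h]
    congr 1
    unfold flipCoord
    split_ifs <;> ring

/-- The composition of isomorphisms. -/
def Iso.trans {π π' π'' : TropicalCover ℓ} (φ : Iso π π') (ψ : Iso π' π'') : Iso π π'' where
  toIso := φ.toIso.trans ψ.toIso
  length_eq := fun e => by
    simp [Multigraph.Iso.trans, ψ.length_eq, φ.length_eq]
  map_eq := fun e t ht => by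
    have h : flipCoord (φ.flip e) (π.C.length e) t ∈ Set.Icc 0 (π'.C.length (φ.edge e)) := by
      rw [φ.length_eq]
      unfold flipCoord
      split_ifs
      · exact ⟨by linarith [ht.2], by linarith [ht.1]⟩
      · exact ht
    rw [← φ.map_eq e t ht, ← ψ.map_eq _ _ h, φ.length_eq]
    simp only [Multigraph.Iso.trans, Equiv.trans_apply]
    congr 1
    unfold flipCoord
    cases φ.flip e <;> cases ψ.flip (φ.edge e) <;> simp

/-- The multiplicity `(∏ₑ wₑ) / |Aut π|`. -/
def mult (π : TropicalCover ℓ) : ℚ :=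
  (∏ e, (π.weight e : ℚ)) / Nat.card (Iso π π)

end TropicalCover

/-- The covers of degree `d` with source of genus `g` and with set of branch points (i.e. images
of the vertices) `{p 1, …, p (2g - 2)}`. -/
def Cover (ℓ : ℝ) (g : ℕ) (p : Fin (2 * g - 2) → AddCircle ℓ) (d : ℕ) : Type 1 :=
  {π : TropicalCover ℓ //
    π.C.genus = g ∧ π.HasDegree d ∧ Set.range π.vmap = Set.range p}

/-- Isomorphism of covers. -/
instance coverSetoid (ℓ : ℝ) (g : ℕ) (p : Fin (2 * g - 2) → AddCircle ℓ) (d : ℕ) :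
    Setoid (Cover ℓ g p d) where
  r π π' := Nonempty (TropicalCover.Iso π.1 π'.1)
  iseqv :=
    { refl := fun π => ⟨TropicalCover.Iso.refl π.1⟩
      symm := fun ⟨φ⟩ => ⟨φ.symm⟩
      trans := fun ⟨φ⟩ ⟨ψ⟩ => ⟨φ.trans ψ⟩ }

/-- The set of isomorphism classes of covers. -/
def CoverClass (ℓ : ℝ) (g : ℕ) (p : Fin (2 * g - 2) → AddCircle ℓ) (d : ℕ) : Type 1 :=
  Quotient (coverSetoid ℓ g p d)

/-- The tropical Hurwitz number: the sum of the multiplicities of one cover from each isomorphism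
class. -/
def tropicalHurwitz (ℓ : ℝ) (g : ℕ) (p : Fin (2 * g - 2) → AddCircle ℓ) (d : ℕ) : ℚ :=
  ∑ᶠ c : CoverClass ℓ g p d, (Quotient.out c).1.mult

/-! ### The propagator and Feynman integrals -/

/-- The Eisenstein series `E₂(q) = 1 - 24 ∑_{d ≥ 1} σ(d) q^d`. -/
def eisensteinE2 (q : ℂ) : ℂ :=
  1 - 24 * ∑' d : ℕ, (ArithmeticFunction.sigma 1 (d + 1) : ℂ) * q ^ (d + 1)

/-- The periods `1, τ`. -/
def periods (τ : UpperHalfPlane) : PeriodPair where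
  ω₁ := 1
  ω₂ := τ
  indep := by
    rw [LinearIndependent.pair_iff]
    intro a b h
    have him := congrArg Complex.im h
    have hb : b = 0 := by
      simpa [τ.im_ne_zero] using him
    subst hb
    have hre := congrArg Complex.re h
    exact ⟨by simpa using hre, rfl⟩

/-- The coordinate `q = exp (π i τ)`. -/
def nome (τ : UpperHalfPlane) : ℂ := Complex.exp (Real.pi * Complex.I * τ)

/-- The propagator `P(z, q) = ℘(z, q) / (4 π²) + E₂(q²) / 12`, where `q = exp (π i τ)` and `℘` is
the Weierstrass function of the lattice `ℤ + ℤτ`. At the poles of `℘`, `weierstrassP` takes the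
value of the finite part, which is `0`; this concerns only the edges of a graph that are loops,
where `P` is evaluated at `z = 0`. -/
def propagator (z : ℂ) (τ : UpperHalfPlane) : ℂ :=
  1 / (4 * (Real.pi : ℂ) ^ 2) * (periods τ).weierstrassP z + 1 / 12 * eisensteinE2 (nome τ ^ 2)

/-- A Feynman graph of genus `g`. -/
def FeynmanGraph (g : ℕ) : Type 1 :=
  {Γ : Multigraph // Γ.Connected ∧ Γ.Trivalent ∧ Γ.genus = g}

/-- Isomorphism of Feynman graphs. -/
instance feynmanSetoid (g : ℕ) : Setoid (FeynmanGraph g) where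
  r Γ Γ' := Nonempty (Multigraph.Iso Γ.1 Γ'.1)
  iseqv :=
    { refl := fun Γ => ⟨Multigraph.Iso.refl Γ.1⟩
      symm := fun ⟨φ⟩ => ⟨φ.symm⟩
      trans := fun ⟨φ⟩ ⟨ψ⟩ => ⟨φ.trans ψ⟩ }

/-- The set of isomorphism classes of Feynman graphs of genus `g`. -/
def FeynmanClass (g : ℕ) : Type 1 := Quotient (feynmanSetoid g)

/-- A total order of the vertices, given by the position of each vertex. -/
abbrev VertexOrder (Γ : Multigraph) : Type := Γ.V ≃ Fin (Fintype.card Γ.V)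

/-- `i y v`, for `v` a vertex, are admissible starting points of the integration paths for the
order `Ω`: the `y v` are ordered as `Ω` says, and they are small, in the sense that their
differences are smaller than the imaginary part of `τ`. -/
def Admissible {Γ : Multigraph} (Ω : VertexOrder Γ) (τ : UpperHalfPlane) (y : Γ.V → ℝ) : Prop :=
  (∀ v w, Ω v < Ω w → y v < y w) ∧ ∀ v w, |y v - y w| < τ.im

/-- The integral of `∏ₑ (-P(z_v - z_w, q))` (where `v`, `w` are the ends of `e`) over the paths
`z_v = i y_v + t_v`, `t_v ∈ [0, 1]`. -/
def feynmanIntegral (Γ : Multigraph) (y : Γ.V → ℝ) (τ : UpperHalfPlane) : ℂ :=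
  ∫ t in Set.Icc (0 : Γ.V → ℝ) 1,
    ∏ e, -propagator ((Complex.I * y (Γ.ends e false) + t (Γ.ends e false)) -
      (Complex.I * y (Γ.ends e true) + t (Γ.ends e true))) τ

open Classical in
/-- The sum of the integrals over all orders `Ω` of the vertices, with starting points `y Ω`. -/
def feynmanSum (Γ : Multigraph) (y : VertexOrder Γ → Γ.V → ℝ) (τ : UpperHalfPlane) : ℂ :=
  ∑ Ω : VertexOrder Γ, feynmanIntegral Γ (y Ω) τ

end TropMirror

end

/-!
For `0 < |Im z| < Im τ`, the value `-P(z)` of the propagator is the sum of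
`|s| exp (2πi s (z + nτ))` over the nonzero integers `s` and the integers `n` such that `s` and
`Im (z + nτ)` have the same sign. Integrating the product over all edges over the real parts of the
`z_v` leaves only the terms whose momenta `s_e` are balanced at every vertex, and such a term
contributes `∏ |s_e| exp (2πiτ) ^ (∑ s_e n_e)`. On a trivalent graph with a loop no flow that is
nonzero on all other edges is balanced, so its integrals vanish.

Place the vertices on the circle in the order `Ω`, and read `s_e` as a slope and `n_e` as a winding
number: these terms are the tropical covers with source `Γ`, with `∏ |s_e|` the product of the
weights and `∑ s_e n_e` the degree. A cover `π` arises once for each isomorphism from `Γ` to its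
source, up to `Aut π`, hence `|Aut Γ| / |Aut π|` times, and division by `|Aut Γ|` leaves the weight
`1 / |Aut π|`.
-/

noncomputable section

namespace TropMirror

section Fourier

open Complex EisensteinSeries

/-- The additive character `x ↦ exp (2 π i x)` of `ℂ`. -/
def expTwoPi : AddChar ℂ ℂ where
  toFun x := exp (2 * Real.pi * I * x)
  map_zero_eq_one' := by simp
  map_add_eq_mul' x y := by rw [mul_add, exp_add]

lemma expTwoPi_apply (x : ℂ) : expTwoPi x = exp (2 * Real.pi * I * x) := rfl

lemma expTwoPi_intCast (n : ℤ) : expTwoPi n = 1 := by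
  rw [expTwoPi_apply, mul_comm, exp_int_mul_two_pi_mul_I]

lemma expTwoPi_int_mul (n : ℤ) (x : ℂ) : expTwoPi (n * x) = expTwoPi x ^ n := by
  rw [← zsmul_eq_mul, AddChar.map_zsmul_eq_zpow]

lemma expTwoPi_nat_mul (n : ℕ) (x : ℂ) : expTwoPi (n * x) = expTwoPi x ^ n := by
  rw [← nsmul_eq_mul, AddChar.map_nsmul_eq_pow]

lemma norm_expTwoPi (x : ℂ) : ‖expTwoPi x‖ = Real.exp (-(2 * Real.pi * x.im)) := by
  simp [expTwoPi_apply, norm_exp]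

lemma nome_sq (τ : UpperHalfPlane) : nome τ ^ 2 = expTwoPi τ := by
  rw [nome, expTwoPi_apply, ← exp_nat_mul]
  ring_nf

/-- The sum of `1 / (x + j) ^ 2` over the integers `j`. A term with `x + j = 0` counts as `0`, just
as the pole is omitted in `PeriodPair.weierstrassP`. -/
def rowSum (x : ℂ) : ℂ := ∑' j : ℤ, 1 / (x + j) ^ 2

lemma summable_rowSum (x : ℂ) : Summable fun j : ℤ => 1 / (x + j) ^ 2 := by
  simpa [zpow_ofNat] using linear_right_summable x 1 (k := 2) le_rfl

lemma rowSum_neg (x : ℂ) : rowSum (-x) = rowSum x := by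
  rw [rowSum, rowSum, ← tsum_comp_neg]
  refine tsum_congr fun j => ?_
  rw [Int.cast_neg, ← neg_add, neg_sq]

lemma rowSum_int_mul (n : ℤ) (τ : UpperHalfPlane) : rowSum (n * τ) = e2Summand n τ := by
  simp [rowSum, e2Summand, eisSummand, zpow_ofNat]

lemma eisensteinE2_nome_sq (τ : UpperHalfPlane) : eisensteinE2 (nome τ ^ 2) = E2 τ := by
  rw [E2_eq_tsum_cexp, eisensteinE2, nome_sq, expTwoPi_apply,
    tsum_pnat_eq_tsum_succ (f := fun d => (ArithmeticFunction.sigma 1 d : ℂ) *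
      exp (2 * Real.pi * I * τ) ^ d)]

lemma hasSum_rowSum_of_pos {x : ℂ} (hx : 0 < x.im) :
    HasSum (fun n : ℕ => (n : ℂ) * expTwoPi (n * x))
      (-(1 / (4 * (Real.pi : ℂ) ^ 2)) * rowSum x) := by
  have norm_lt_one : ‖expTwoPi x‖ < 1 := by
    rw [norm_expTwoPi, Real.exp_lt_one_iff, neg_lt_zero]
    positivity
  have expansion : rowSum x = -(4 * (Real.pi : ℂ) ^ 2) * ∑' n : ℕ, (n : ℂ) * expTwoPi x ^ n := by
    have h := qExpansion_identity le_rfl ⟨x, hx⟩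
    norm_num [mul_pow] at h
    simpa [rowSum, expTwoPi_apply] using h
  have hπ : (Real.pi : ℂ) ≠ 0 := ofReal_ne_zero.2 Real.pi_ne_zero
  have summable : Summable fun n : ℕ => (n : ℂ) * expTwoPi x ^ n := by
    simpa only [pow_one] using summable_pow_mul_geometric_of_norm_lt_one 1 norm_lt_one
  have sum_eq : -(1 / (4 * (Real.pi : ℂ) ^ 2)) * rowSum x = ∑' n : ℕ, (n : ℂ) * expTwoPi x ^ n := by
    rw [expansion]
    field_simp
  simpa only [expTwoPi_nat_mul, sum_eq] using summable.hasSum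

lemma hasSum_rowSum {x : ℂ} (hx : x.im ≠ 0) :
    HasSum (fun s : ℤ => if 0 < s * x.im then (s.natAbs : ℂ) * expTwoPi (s * x) else 0)
      (-(1 / (4 * (Real.pi : ℂ) ^ 2)) * rowSum x) := by
  wlog pos : 0 < x.im generalizing x
  · have h := this (x := -x) (by simpa using hx) (by simpa using hx.lt_of_le (not_lt.1 pos))
    rw [rowSum_neg, ← (Equiv.neg ℤ).hasSum_iff] at h
    simpa [Function.comp_def] using h
  rw [← (Nat.cast_injective (R := ℤ)).hasSum_iff]
  · convert hasSum_rowSum_of_pos pos using 2 with n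
    rcases n.eq_zero_or_pos with rfl | hn
    · simp
    · simp [mul_pos (Nat.cast_pos.2 hn) pos]
  · intro s hs
    rw [if_neg]
    rw [mul_pos_iff_of_pos_right pos, Int.cast_pos]
    exact fun h => hs ⟨s.toNat, Int.toNat_of_nonneg h.le⟩

/-- The term of the Fourier expansion of the propagator at `z` with momentum `a.1` and winding
number `a.2`. It vanishes unless `a.1` and `Im (z + a.2 τ)` have the same sign. -/
def fourierTerm (z τ : ℂ) (a : ℤ × ℤ) : ℂ :=
  if 0 < a.1 * (z.im + a.2 * τ.im) then (a.1.natAbs : ℂ) * expTwoPi (a.1 * (z + a.2 * τ)) else 0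

lemma exists_mul_le_abs_add_mul {θ η : ℝ} (hθ : θ ≠ 0) (h : |θ| < η) :
    ∃ δ > 0, ∀ n : ℤ, δ * (|(n : ℝ)| + 1) ≤ |θ + n * η| := by
  set m := min |θ| (η - |θ|)
  have m_pos : 0 < m := lt_min (abs_pos.2 hθ) (sub_pos.2 h)
  refine ⟨m / 2, half_pos m_pos, fun n => ?_⟩
  rcases eq_or_ne n 0 with rfl | hn
  · simp only [Int.cast_zero, abs_zero, zero_add, mul_one, zero_mul, add_zero]
    linarith [min_le_left |θ| (η - |θ|)]
  · have one_le : (1 : ℝ) ≤ |(n : ℝ)| := by exact_mod_cast Int.one_le_abs hn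
    have triangle : |(n : ℝ)| * η - |θ| ≤ |θ + n * η| := by
      have := abs_sub_abs_le_abs_sub (n * η) (-θ)
      rwa [abs_mul, abs_neg, abs_of_pos ((abs_nonneg θ).trans_lt h), sub_neg_eq_add,
        add_comm (_ * η) θ] at this
    have gap : m ≤ η - |θ| := min_le_right _ _
    nlinarith [abs_nonneg θ]

lemma norm_fourierTerm_le {z τ : ℂ} {δ : ℝ} (hδ : 0 < δ)
    (h : ∀ n : ℤ, δ * (|(n : ℝ)| + 1) ≤ |z.im + n * τ.im|) (a : ℤ × ℤ) :
    ‖fourierTerm z τ a‖ ≤ (a.1.natAbs : ℝ) ^ 1 * Real.exp (-(2 * Real.pi * δ)) ^ a.1.natAbs *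
      ((a.2.natAbs : ℝ) ^ 0 * Real.exp (-(2 * Real.pi * δ)) ^ a.2.natAbs) := by
  obtain ⟨s, n⟩ := a
  unfold fourierTerm
  split_ifs with hs
  · have one_le : (1 : ℝ) ≤ |(s : ℝ)| := by
      have : s ≠ 0 := by rintro rfl; simp at hs
      exact_mod_cast Int.one_le_abs this
    have exponent_le : δ * (|(s : ℝ)| + |(n : ℝ)|) ≤ s * (z.im + n * τ.im) :=
      calc δ * (|(s : ℝ)| + |(n : ℝ)|) ≤ δ * (|(s : ℝ)| * (|(n : ℝ)| + 1)) := by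
            gcongr
            nlinarith [abs_nonneg (n : ℝ)]
        _ = |(s : ℝ)| * (δ * (|(n : ℝ)| + 1)) := by ring
        _ ≤ |(s : ℝ)| * |z.im + n * τ.im| := by gcongr; exact h n
        _ = s * (z.im + n * τ.im) := by rw [← abs_mul, abs_of_pos hs]
    rw [norm_mul, norm_expTwoPi, pow_one, pow_zero, one_mul, mul_assoc (s.natAbs : ℝ), ← pow_add,
      ← Real.exp_nat_mul, norm_natCast]
    gcongr
    simp only [Nat.cast_add, Nat.cast_natAbs, Int.cast_abs, mul_im, intCast_re, intCast_im,
      add_im, zero_mul, add_zero]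
    nlinarith [mul_le_mul_of_nonneg_left exponent_le Real.two_pi_pos.le]
  · rw [norm_zero]
    positivity

lemma summable_natAbs_mul_pow {r : ℝ} (hr : ‖r‖ < 1) (k : ℕ) :
    Summable fun s : ℤ => (s.natAbs : ℝ) ^ k * r ^ s.natAbs := by
  have h := summable_pow_mul_geometric_of_norm_lt_one k hr
  exact .of_nat_of_neg (by simpa using h) (by simpa using h)

lemma summable_norm_fourierTerm {z τ : ℂ} (hz : z.im ≠ 0) (h : |z.im| < τ.im) :
    Summable fun a => ‖fourierTerm z τ a‖ := by
  obtain ⟨δ, hδ, le_abs⟩ := exists_mul_le_abs_add_mul hz h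
  have hr : ‖Real.exp (-(2 * Real.pi * δ))‖ < 1 := by
    rw [Real.norm_of_nonneg (Real.exp_pos _).le, Real.exp_lt_one_iff, neg_lt_zero]
    positivity
  refine .of_nonneg_of_le (fun _ => norm_nonneg _) (norm_fourierTerm_le hδ le_abs) ?_
  exact (summable_natAbs_mul_pow hr 1).mul_of_nonneg (summable_natAbs_mul_pow hr 0)
    (fun _ => by positivity) (fun _ => by positivity)

lemma hasSum_rowSum_add_int_mul {z τ : ℂ} (hz : z.im ≠ 0) (h : |z.im| < τ.im) :
    HasSum (fun n : ℤ => rowSum (z + n * τ))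
      (-(4 * (Real.pi : ℂ) ^ 2) * ∑' a, fourierTerm z τ a) := by
  have im_ne_zero (n : ℤ) : (z + n * τ).im ≠ 0 := by
    obtain ⟨δ, hδ, le_abs⟩ := exists_mul_le_abs_add_mul hz h
    have : 0 < |z.im + n * τ.im| := lt_of_lt_of_le (by positivity) (le_abs n)
    simpa using abs_pos.1 this
  have rows : HasSum (fun n : ℤ => -(1 / (4 * (Real.pi : ℂ) ^ 2)) * rowSum (z + n * τ))
      (∑' a, fourierTerm z τ a) := by
    have total := (summable_norm_fourierTerm hz h).of_norm.hasSum
    rw [← (Equiv.prodComm ℤ ℤ).hasSum_iff] at total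
    refine total.prod_fiberwise fun n => ?_
    simpa [fourierTerm] using hasSum_rowSum (im_ne_zero n)
  have hπ : (Real.pi : ℂ) ≠ 0 := ofReal_ne_zero.2 Real.pi_ne_zero
  refine (rows.mul_left (-(4 * (Real.pi : ℂ) ^ 2))).congr_fun fun n => ?_
  field_simp

lemma hasSum_weierstrassP_rows (z : ℂ) (τ : UpperHalfPlane) :
    HasSum (fun n : ℤ => rowSum (z + n * τ) - rowSum (n * τ)) ((periods τ).weierstrassP z) := by
  have h := (periods τ).hasSum_weierstrassP (-z)
  rw [PeriodPair.weierstrassP_neg,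
    ← ((Equiv.prodComm ℤ ℤ).trans (periods τ).latticeEquivProd.symm.toEquiv).hasSum_iff] at h
  refine h.prod_fiberwise fun n => ?_
  refine ((summable_rowSum _).hasSum.sub (summable_rowSum _).hasSum).congr_fun fun j => ?_
  have hl := (periods τ).latticeEquiv_symm_apply (j, n)
  simp only [Function.comp_apply, Equiv.trans_apply, Equiv.prodComm_apply, Prod.swap_prod_mk,
    LinearEquiv.coe_toEquiv]
  rw [hl]
  simp only [periods]
  congr 2 <;> ring

lemma G2_eq_E2 (τ : UpperHalfPlane) : G2 τ = (Real.pi : ℂ) ^ 2 / 3 * E2 τ := by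
  rw [G2_eq_tsum_cexp, E2_eq_tsum_cexp, riemannZeta_two]
  ring

theorem hasSum_fourierTerm {z : ℂ} {τ : UpperHalfPlane} (hz : z.im ≠ 0) (h : |z.im| < τ.im) :
    HasSum (fourierTerm z τ) (-propagator z τ) := by
  have hπ : (Real.pi : ℂ) ≠ 0 := ofReal_ne_zero.2 Real.pi_ne_zero
  have rows := hasSum_rowSum_add_int_mul hz h
  have differences := hasSum_weierstrassP_rows z τ
  have eisenstein : HasSum (fun n : ℤ => rowSum (n * τ)) (G2 τ) := by
    have summable : Summable fun n : ℤ => e2Summand n τ :=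
      (rows.summable.sub differences.summable).congr fun n => by
        rw [sub_sub_cancel, rowSum_int_mul]
    simpa only [rowSum_int_mul, G2, tsum_eq_of_summable_unconditional summable]
      using summable.hasSum
  have sum_eq : -(4 * (Real.pi : ℂ) ^ 2) * ∑' a, fourierTerm z τ a =
      (periods τ).weierstrassP z + G2 τ := by
    refine rows.unique ?_
    simpa only [sub_add_cancel] using differences.add eisenstein
  suffices propagator_eq : -propagator z τ = ∑' a, fourierTerm z τ a by
    rw [propagator_eq]
    exact (summable_norm_fourierTerm hz h).of_norm.hasSum
  rw [propagator, eisensteinE2_nome_sq]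
  rw [G2_eq_E2] at sum_eq
  field_simp
  linear_combination 12 * sum_eq

end Fourier

namespace Multigraph

variable {G : Multigraph}

section Excess

variable {A : Type*} [AddCommGroup A]

/-- The flow that leaves a vertex through a half-edge, if `s e` flows through the edge `e` in its
reference direction. -/
def halfFlow (s : G.E → A) (x : G.E × Bool) : A := if x.2 then -s x.1 else s x.1

open Classical in
/-- The total flow that leaves a vertex, if `s e` flows through the edge `e`. -/
def excess (s : G.E → A) (v : G.V) : A :=
  ∑ x : G.E × Bool with G.ends x.1 x.2 = v, halfFlow s x

lemma sum_smul_sub_eq {R M : Type*} [Ring R] [AddCommGroup M] [Module R M] (s : G.E → R)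
    (f : G.V → M) :
    ∑ e, s e • (f (G.ends e true) - f (G.ends e false)) = -∑ v, excess s v • f v := by
  classical
  have by_halfEdges : ∑ v, excess s v • f v =
      ∑ x : G.E × Bool, halfFlow s x • f (G.ends x.1 x.2) := by
    rw [← Finset.sum_fiberwise (s := Finset.univ) (g := fun x : G.E × Bool => G.ends x.1 x.2)]
    refine Finset.sum_congr rfl fun v _ => ?_
    rw [excess, Finset.sum_smul]
    refine Finset.sum_congr (by congr) fun x hx => ?_
    rw [(Finset.mem_filter.1 hx).2]
  rw [by_halfEdges, Fintype.sum_prod_type, ← Finset.sum_neg_distrib]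
  refine Finset.sum_congr rfl fun e _ => ?_
  simp only [Fintype.sum_bool, halfFlow, if_true, Bool.false_eq_true, if_false,
    neg_smul, smul_sub]
  abel

lemma sum_smul_sub_eq_zero {R M : Type*} [Ring R] [AddCommGroup M] [Module R M] {s : G.E → R}
    (hs : ∀ v, excess s v = 0) (f : G.V → M) :
    ∑ e, s e • (f (G.ends e true) - f (G.ends e false)) = 0 := by
  simp only [sum_smul_sub_eq, hs, zero_smul, Finset.sum_const_zero, neg_zero]

open Classical in
lemma exists_halfEdges_eq_of_loop (hG : G.Trivalent) {e : G.E}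
    (he : G.ends e false = G.ends e true) :
    ∃ x : G.E × Bool, x.1 ≠ e ∧
      ({x | G.ends x.1 x.2 = G.ends e true} : Finset (G.E × Bool)) =
        {(e, false), (e, true), x} := by
  set F : Finset (G.E × Bool) := {x | G.ends x.1 x.2 = G.ends e true} with hF
  have card_F : F.card = 3 := by
    rw [← hG (G.ends e true), Nat.card_eq_fintype_card, Fintype.card_subtype]
  have subset : {(e, false), (e, true)} ⊆ F := by
    simp [hF, Finset.insert_subset_iff, he]
  have card_sdiff : (F \ {(e, false), (e, true)}).card = 1 := by
    rw [Finset.card_sdiff_of_subset subset, card_F, Finset.card_pair (by simp)]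
  obtain ⟨x, hx⟩ := Finset.card_eq_one.1 card_sdiff
  have x_mem : x ∈ F \ {(e, false), (e, true)} := by simp [hx]
  refine ⟨x, ?_, ?_⟩
  · rintro rfl
    obtain ⟨e, _ | _⟩ := x <;> simp at x_mem
  · rw [← Finset.union_sdiff_of_subset subset, hx, Finset.insert_union,
      Finset.singleton_union]

lemma ends_ne_of_excess_eq_zero (hG : G.Trivalent) {s : G.E → A} (hs : ∀ v, excess s v = 0)
    (h : ∀ e, G.ends e false ≠ G.ends e true → s e ≠ 0) (e : G.E) :
    G.ends e false ≠ G.ends e true := by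
  classical
  intro he
  -- The flow through a loop cancels at its vertex, so the third half-edge there carries no flow;
  -- its edge is then a second loop at a vertex with three half-edges.
  obtain ⟨⟨e', b⟩, hne : e' ≠ e, halfEdges_eq⟩ := exists_halfEdges_eq_of_loop hG he
  have flow_eq_zero : s e' = 0 := by
    have := hs (G.ends e true)
    rw [excess, halfEdges_eq, Finset.sum_insert, Finset.sum_pair] at this
    · cases b <;> simpa [halfFlow] using this
    · simp [hne.symm]
    · simp [hne.symm]
  have loop : G.ends e' false = G.ends e' true := by
    by_contra hne
    exact h _ hne flow_eq_zero
  have mem : G.ends e' b = G.ends e true := by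
    simpa using (Finset.ext_iff.1 halfEdges_eq (e', b)).2 (by simp)
  have other_mem : (e', !b) ∈ ({(e, false), (e, true), (e', b)} : Finset (G.E × Bool)) := by
    rw [← halfEdges_eq, Finset.mem_filter]
    cases b
    · exact ⟨Finset.mem_univ _, loop.symm.trans mem⟩
    · exact ⟨Finset.mem_univ _, loop.trans mem⟩
  simp [hne] at other_mem

end Excess

/-- The signed distance from the start to the end of an edge that has winding number `(a e).2`, if
the vertices are placed at `P` on a circle of length `ℓ`. -/
def displacement (P : G.V → ℝ) (ℓ : ℝ) (a : G.E → ℤ × ℤ) (e : G.E) : ℝ :=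
  P (G.ends e true) - P (G.ends e false) + (a e).2 * ℓ

/-- A balanced assignment of slopes `(a e).1` and winding numbers `(a e).2` to the edges, such that
every edge runs in the direction of its slope if the vertices are placed at `P` on a circle of
length `ℓ`. -/
def IsFlow (P : G.V → ℝ) (ℓ : ℝ) (a : G.E → ℤ × ℤ) : Prop :=
  (∀ v, excess (fun e => (a e).1) v = 0) ∧ ∀ e, 0 < (a e).1 * displacement P ℓ a e

/-- The total winding number of the edges, weighted by their slopes: the degree of the cover that
corresponds to a flow. -/
def turns (a : G.E → ℤ × ℤ) : ℤ := ∑ e, (a e).1 * (a e).2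

end Multigraph

lemma add_int_mul_pos_iff {K : Type*} [CommRing K] [LinearOrder K] [IsStrictOrderedRing K]
    {x ℓ : K} (h : |x| < ℓ) (n : ℤ) : 0 < x + n * ℓ ↔ 0 < n ∨ n = 0 ∧ 0 < x := by
  obtain ⟨hl, hr⟩ := abs_lt.1 h
  rcases lt_trichotomy n 0 with hn | rfl | hn
  · have : (n : K) ≤ -1 := by exact_mod_cast Int.le_sub_one_of_lt hn
    have : ¬ 0 < x + n * ℓ := by nlinarith
    simp [this, hn.not_gt, hn.ne]
  · simp
  · have : (1 : K) ≤ n := by exact_mod_cast hn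
    have : 0 < x + n * ℓ := by nlinarith
    simp [this, hn]

lemma add_int_mul_neg_iff {K : Type*} [CommRing K] [LinearOrder K] [IsStrictOrderedRing K]
    {x ℓ : K} (h : |x| < ℓ) (n : ℤ) : x + n * ℓ < 0 ↔ n < 0 ∨ n = 0 ∧ x < 0 := by
  have := add_int_mul_pos_iff (x := -x) (by rwa [abs_neg]) (-n)
  rwa [Int.cast_neg, neg_mul, ← neg_add, neg_pos, neg_pos, neg_eq_zero, neg_pos] at this

namespace Multigraph

variable {G : Multigraph} {P P' : G.V → ℝ} {ℓ ℓ' : ℝ} {a : G.E → ℤ × ℤ}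

lemma isFlow_congr (h : ∀ v w, |P v - P w| < ℓ) (h' : ∀ v w, |P' v - P' w| < ℓ')
    (lt_iff : ∀ v w, P v < P w ↔ P' v < P' w) : IsFlow P ℓ a ↔ IsFlow P' ℓ' a := by
  simp only [IsFlow, displacement, mul_pos_iff, Int.cast_pos, Int.cast_lt_zero,
    add_int_mul_pos_iff (h _ _), add_int_mul_neg_iff (h _ _), add_int_mul_pos_iff (h' _ _),
    add_int_mul_neg_iff (h' _ _), sub_pos, sub_neg, lt_iff]

namespace IsFlow

lemma fst_ne_zero (ha : IsFlow P ℓ a) (e : G.E) : (a e).1 ≠ 0 := by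
  intro h
  simpa [h] using ha.2 e

lemma sum_mul_eq (ha : IsFlow P ℓ a) :
    ∑ e, ((a e).1 : ℝ) * displacement P ℓ a e = turns a * ℓ := by
  have h := sum_smul_sub_eq_zero ha.1 P
  simp only [zsmul_eq_mul] at h
  simp only [displacement, mul_add, Finset.sum_add_distrib, h, zero_add, turns, Int.cast_sum,
    Int.cast_mul, Finset.sum_mul, mul_assoc]

lemma turns_pos [Nonempty G.E] (hℓ : 0 < ℓ) (ha : IsFlow P ℓ a) : 0 < turns a := by
  have h : 0 < (turns a : ℝ) * ℓ := by
    rw [← ha.sum_mul_eq]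
    exact Finset.sum_pos (fun e _ => ha.2 e) Finset.univ_nonempty
  exact_mod_cast pos_of_mul_pos_left h hℓ.le

end IsFlow

end Multigraph

lemma summable_norm_prod_and_hasSum_prod_fin {κ R : Type*} [NormedCommRing R] [CompleteSpace R]
    {n : ℕ} (f : Fin n → κ → R) (hf : ∀ i, Summable fun x => ‖f i x‖) :
    Summable (fun a : Fin n → κ => ‖∏ i, f i (a i)‖) ∧
      HasSum (fun a : Fin n → κ => ∏ i, f i (a i)) (∏ i, ∑' x, f i x) := by
  induction n with
  | zero => exact ⟨(hasSum_fintype _).summable, by simp⟩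
  | succ n ih =>
    obtain ⟨summable, hasSum⟩ := ih (fun i => f i.succ) fun i => hf i.succ
    have summable' := (hf 0).mul_norm summable
    have hasSum' := (hf 0).of_norm.hasSum.mul hasSum summable'.of_norm
    rw [← (Fin.consEquiv fun _ => κ).symm.summable_iff] at summable'
    rw [← (Fin.consEquiv fun _ => κ).symm.hasSum_iff] at hasSum'
    simp only [Fin.prod_univ_succ]
    exact ⟨summable', hasSum'⟩

lemma summable_norm_prod_and_hasSum_prod {ι κ R : Type*} [Fintype ι] [NormedCommRing R]
    [CompleteSpace R] (f : ι → κ → R) (hf : ∀ i, Summable fun x => ‖f i x‖) :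
    Summable (fun a : ι → κ => ‖∏ i, f i (a i)‖) ∧
      HasSum (fun a : ι → κ => ∏ i, f i (a i)) (∏ i, ∑' x, f i x) := by
  let e := (Fintype.equivFin ι).symm
  obtain ⟨summable, hasSum⟩ :=
    summable_norm_prod_and_hasSum_prod_fin (fun i => f (e i)) fun i => hf (e i)
  have prod_eq (a : ι → κ) : ∏ i, f (e i) (a (e i)) = ∏ i, f i (a i) :=
    e.prod_comp fun i => f i (a i)
  rw [e.prod_comp fun i => ∑' x, f i x,
    ← (Equiv.arrowCongr e.symm (Equiv.refl κ)).hasSum_iff] at hasSum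
  rw [← (Equiv.arrowCongr e.symm (Equiv.refl κ)).summable_iff] at summable
  exact ⟨summable.congr fun a => congrArg norm (prod_eq a),
    hasSum.congr_fun fun a => (prod_eq a).symm⟩

section FeynmanIntegral

open Complex MeasureTheory Multigraph

lemma expTwoPi_sum {ι : Type*} (s : Finset ι) (f : ι → ℂ) :
    expTwoPi (∑ i ∈ s, f i) = ∏ i ∈ s, expTwoPi (f i) := by
  simp only [expTwoPi_apply, Finset.mul_sum, exp_sum]

lemma integral_expTwoPi (m : ℤ) :
    ∫ t in Set.Icc (0 : ℝ) 1, expTwoPi (m * t) = if m = 0 then 1 else 0 := by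
  rw [integral_Icc_eq_integral_Ioc, ← intervalIntegral.integral_of_le zero_le_one]
  split_ifs with h
  · simp [h]
  · have hm : (2 * Real.pi * I * m : ℂ) ≠ 0 := by
      simp [Real.pi_ne_zero, h]
    have exp_eq_one : exp (2 * Real.pi * I * m) = 1 := expTwoPi_intCast m
    simp only [expTwoPi_apply, ← mul_assoc]
    rw [integral_exp_mul_complex hm]
    simp [exp_eq_one]

lemma integral_prod_expTwoPi {V : Type*} [Fintype V] (m : V → ℤ) :
    ∫ t in Set.Icc (0 : V → ℝ) 1, ∏ v, expTwoPi (m v * t v) = if ∀ v, m v = 0 then 1 else 0 := by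
  classical
  rw [← Set.pi_univ_Icc, volume_pi, Measure.restrict_pi_pi,
    integral_fintype_prod_eq_prod (fun v (t : ℝ) => expTwoPi (m v * t))]
  simp only [Pi.zero_apply, Pi.one_apply, integral_expTwoPi, Finset.prod_ite_zero, Finset.mem_univ,
    true_imp_iff, Finset.prod_const_one]

lemma propagator_neg (z : ℂ) (τ : UpperHalfPlane) : propagator (-z) τ = propagator z τ := by
  rw [propagator, propagator, PeriodPair.weierstrassP_neg]

lemma fourierTerm_add_ofReal (z τ : ℂ) (x : ℝ) (a : ℤ × ℤ) :
    fourierTerm (z + x) τ a = fourierTerm z τ a * expTwoPi (a.1 * x) := by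
  rw [fourierTerm, fourierTerm, add_im, ofReal_im, add_zero, ite_mul, zero_mul, mul_assoc,
    ← AddChar.map_add_eq_mul]
  ring_nf

variable {Γ : Multigraph} {y : Γ.V → ℝ} {τ : UpperHalfPlane}

/-- The difference `z_w - z_v` along an edge from `v` to `w`, if `z_u = i y_u + t_u`. -/
def edgeArg (y t : Γ.V → ℝ) (e : Γ.E) : ℂ :=
  (I * y (Γ.ends e true) + t (Γ.ends e true)) - (I * y (Γ.ends e false) + t (Γ.ends e false))

lemma edgeArg_im (y t : Γ.V → ℝ) (e : Γ.E) :
    (edgeArg y t e).im = y (Γ.ends e true) - y (Γ.ends e false) := by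
  simp [edgeArg]

lemma edgeArg_eq (y t : Γ.V → ℝ) (e : Γ.E) :
    edgeArg y t e = edgeArg y 0 e + (t (Γ.ends e true) - t (Γ.ends e false) : ℝ) := by
  simp only [edgeArg, Pi.zero_apply, ofReal_zero, ofReal_sub]
  ring

lemma edgeArg_im_ne_zero (hy : Function.Injective y) (t : Γ.V → ℝ) {e : Γ.E}
    (he : Γ.ends e false ≠ Γ.ends e true) : (edgeArg y t e).im ≠ 0 := by
  rw [edgeArg_im, sub_ne_zero]
  exact hy.ne he.symm

open Classical in
/-- The expansion of the factor `-P` of the integrand that belongs to an edge. At a loop `P` is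
evaluated at `0`, outside the range of its Fourier expansion: there the series has one term. -/
def edgeTerm (y : Γ.V → ℝ) (τ : UpperHalfPlane) (t : Γ.V → ℝ) (e : Γ.E) (a : ℤ × ℤ) : ℂ :=
  if Γ.ends e false = Γ.ends e true then (if a = 0 then -propagator 0 τ else 0)
  else fourierTerm (edgeArg y t e) τ a

lemma edgeTerm_eq_mul (y t : Γ.V → ℝ) (τ : UpperHalfPlane) (e : Γ.E) (a : ℤ × ℤ) :
    edgeTerm y τ t e a =
      edgeTerm y τ 0 e a * expTwoPi (a.1 * (t (Γ.ends e true) - t (Γ.ends e false))) := by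
  unfold edgeTerm
  split_ifs with hloop ha
  · simp [ha]
  · simp
  · rw [edgeArg_eq, fourierTerm_add_ofReal, ofReal_sub]

lemma summable_norm_edgeTerm (hy : Function.Injective y) (hy' : ∀ v w, |y v - y w| < τ.im)
    (t : Γ.V → ℝ) (e : Γ.E) : Summable fun a => ‖edgeTerm y τ t e a‖ := by
  unfold edgeTerm
  split_ifs with he
  · exact (hasSum_ite_eq 0 _).summable.norm
  · exact summable_norm_fourierTerm (edgeArg_im_ne_zero hy t he)
      (by rw [edgeArg_im]; exact hy' _ _)

lemma tsum_edgeTerm (hy : Function.Injective y) (hy' : ∀ v w, |y v - y w| < τ.im)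
    (t : Γ.V → ℝ) (e : Γ.E) : ∑' a, edgeTerm y τ t e a = -propagator (-edgeArg y t e) τ := by
  unfold edgeTerm
  split_ifs with he
  · rw [tsum_ite_eq, edgeArg, he, sub_self, neg_zero]
  · rw [propagator_neg]
    exact (hasSum_fourierTerm (edgeArg_im_ne_zero hy t he)
      (by rw [edgeArg_im]; exact hy' _ _)).tsum_eq

lemma feynmanIntegral_eq (y : Γ.V → ℝ) (τ : UpperHalfPlane) : feynmanIntegral Γ y τ =
    ∫ t in Set.Icc (0 : Γ.V → ℝ) 1, ∏ e, -propagator (-edgeArg y t e) τ := by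
  simp only [feynmanIntegral, edgeArg, neg_sub]

lemma prod_edgeTerm_eq_mul (y t : Γ.V → ℝ) (τ : UpperHalfPlane) (a : Γ.E → ℤ × ℤ) :
    ∏ e, edgeTerm y τ t e (a e) = (∏ e, edgeTerm y τ 0 e (a e)) *
      ∏ v, expTwoPi ((-excess (fun e => (a e).1) v : ℤ) * t v) := by
  have by_parts := sum_smul_sub_eq (fun e => (a e).1) fun v => (t v : ℂ)
  simp only [zsmul_eq_mul, ← Finset.sum_neg_distrib, ← neg_mul, ← Int.cast_neg] at by_parts
  rw [← expTwoPi_sum, ← by_parts, expTwoPi_sum, ← Finset.prod_mul_distrib]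
  exact Finset.prod_congr rfl fun e _ => edgeTerm_eq_mul y t τ e (a e)

lemma norm_prod_edgeTerm (y t : Γ.V → ℝ) (τ : UpperHalfPlane) (a : Γ.E → ℤ × ℤ) :
    ‖∏ e, edgeTerm y τ t e (a e)‖ = ‖∏ e, edgeTerm y τ 0 e (a e)‖ := by
  simp [prod_edgeTerm_eq_mul y t, norm_expTwoPi]

/-- The contribution of a flow to the Feynman integral. -/
def flowTerm (τ : UpperHalfPlane) (a : Γ.E → ℤ × ℤ) : ℂ :=
  (∏ e, ((a e).1.natAbs : ℂ)) * expTwoPi τ ^ turns a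

lemma prod_edgeTerm_of_isFlow (hΓ : Γ.Trivalent) {a : Γ.E → ℤ × ℤ} (ha : IsFlow y τ.im a) :
    ∏ e, edgeTerm y τ 0 e (a e) = flowTerm τ a := by
  have no_loop := ends_ne_of_excess_eq_zero hΓ ha.1 fun e _ => ha.fst_ne_zero e
  have edgeTerm_eq (e) : edgeTerm y τ 0 e (a e) = ((a e).1.natAbs : ℂ) *
      expTwoPi ((a e).1 * (I * y (Γ.ends e true) - I * y (Γ.ends e false)) +
        ((a e).1 * (a e).2 : ℤ) * τ) := by
    rw [edgeTerm, if_neg (no_loop e), fourierTerm, edgeArg_im, τ.coe_im, ← displacement,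
      if_pos (ha.2 e)]
    simp only [edgeArg, Pi.zero_apply, ofReal_zero, add_zero, mul_add, Int.cast_mul, mul_assoc]
  have balanced := sum_smul_sub_eq_zero ha.1 fun v => I * (y v : ℂ)
  simp only [zsmul_eq_mul] at balanced
  rw [Finset.prod_congr rfl fun e _ => edgeTerm_eq e, Finset.prod_mul_distrib,
    ← expTwoPi_sum, Finset.sum_add_distrib, balanced, zero_add, ← Finset.sum_mul,
    flowTerm, ← expTwoPi_int_mul, turns, Int.cast_sum]

lemma isFlow_of_prod_edgeTerm_ne_zero (hΓ : Γ.Trivalent) {a : Γ.E → ℤ × ℤ}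
    (ha : ∀ v, excess (fun e => (a e).1) v = 0) (h : ∏ e, edgeTerm y τ 0 e (a e) ≠ 0) :
    IsFlow y τ.im a := by
  have pos (e) (he : Γ.ends e false ≠ Γ.ends e true) :
      0 < (a e).1 * displacement y τ.im a e := by
    have ne_zero := Finset.prod_ne_zero_iff.1 h e (Finset.mem_univ e)
    rw [edgeTerm, if_neg he, fourierTerm, edgeArg_im] at ne_zero
    by_contra hn
    exact ne_zero (if_neg hn)
  refine ⟨ha, fun e => pos e (ends_ne_of_excess_eq_zero hΓ ha (fun e he h0 => ?_) e)⟩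
  simpa [h0] using pos e he

open Classical in
lemma integral_prod_edgeTerm (hΓ : Γ.Trivalent) (a : Γ.E → ℤ × ℤ) :
    ∫ t in Set.Icc (0 : Γ.V → ℝ) 1, ∏ e, edgeTerm y τ t e (a e) =
      if IsFlow y τ.im a then flowTerm τ a else 0 := by
  rw [integral_congr_ae (.of_forall fun t => prod_edgeTerm_eq_mul y t τ a), integral_const_mul,
    integral_prod_expTwoPi]
  simp only [neg_eq_zero]
  by_cases balanced : ∀ v, excess (fun e => (a e).1) v = 0
  · rw [if_pos balanced, mul_one]
    split_ifs with flow
    · exact prod_edgeTerm_of_isFlow hΓ flow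
    · exact not_imp_comm.1 (isFlow_of_prod_edgeTerm_ne_zero hΓ balanced) flow
  · rw [if_neg balanced, mul_zero, if_neg fun flow : IsFlow y τ.im a => balanced flow.1]

lemma integrableOn_prod_edgeTerm (y : Γ.V → ℝ) (τ : UpperHalfPlane) (a : Γ.E → ℤ × ℤ) :
    IntegrableOn (fun t => ∏ e, edgeTerm y τ t e (a e)) (Set.Icc (0 : Γ.V → ℝ) 1) := by
  rw [funext fun t => prod_edgeTerm_eq_mul y t τ a]
  simp only [expTwoPi_apply]
  refine ContinuousOn.integrableOn_compact isCompact_Icc ?_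
  fun_prop

lemma summable_norm_prod_edgeTerm (hy : Function.Injective y) (hy' : ∀ v w, |y v - y w| < τ.im) :
    Summable fun a : Γ.E → ℤ × ℤ => ‖∏ e, edgeTerm y τ 0 e (a e)‖ :=
  (summable_norm_prod_and_hasSum_prod _ (summable_norm_edgeTerm hy hy' 0)).1

open Classical in
lemma summable_norm_flowTerm (hΓ : Γ.Trivalent) (hy : Function.Injective y)
    (hy' : ∀ v w, |y v - y w| < τ.im) :
    Summable fun a : Γ.E → ℤ × ℤ => ‖if IsFlow y τ.im a then flowTerm τ a else 0‖ := by
  refine (summable_norm_prod_edgeTerm hy hy').of_nonneg_of_le (fun _ => norm_nonneg _) fun a => ?_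
  split_ifs with flow
  · rw [prod_edgeTerm_of_isFlow hΓ flow]
  · rw [norm_zero]
    exact norm_nonneg _

open Classical in
theorem hasSum_feynmanIntegral (hΓ : Γ.Trivalent) (hy : Function.Injective y)
    (hy' : ∀ v w, |y v - y w| < τ.im) :
    HasSum (fun a => if IsFlow y τ.im a then flowTerm τ a else 0) (feynmanIntegral Γ y τ) := by
  have volume_eq_one : volume.real (Set.Icc (0 : Γ.V → ℝ) 1) = 1 := by
    simp [Measure.real, Real.volume_Icc_pi]
  have expansion (t : Γ.V → ℝ) :
      ∑' a : Γ.E → ℤ × ℤ, ∏ e, edgeTerm y τ t e (a e) = ∏ e, -propagator (-edgeArg y t e) τ := by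
    simp only [← tsum_edgeTerm hy hy' t]
    exact (summable_norm_prod_and_hasSum_prod _ (summable_norm_edgeTerm hy hy' t)).2.tsum_eq
  have termwise := hasSum_integral_of_summable_integral_norm
    (F := fun (a : Γ.E → ℤ × ℤ) (t : Γ.V → ℝ) => ∏ e, edgeTerm y τ t e (a e))
    (fun a => integrableOn_prod_edgeTerm y τ a)
    (by simpa [norm_prod_edgeTerm y _ τ, volume_eq_one] using summable_norm_prod_edgeTerm hy hy')
  simpa only [integral_prod_edgeTerm hΓ, expansion, ← feynmanIntegral_eq] using termwise

end FeynmanIntegral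

section FlowCount

open Multigraph

variable {Γ : Multigraph} {P y : Γ.V → ℝ} {ℓ : ℝ} {τ : UpperHalfPlane} {d : ℕ}

/-- The flows that turn `d` times around the circle. -/
def flows (P : Γ.V → ℝ) (ℓ : ℝ) (d : ℕ) : Set (Γ.E → ℤ × ℤ) :=
  {a | IsFlow P ℓ a ∧ turns a = d}

/-- The number of flows that turn `d` times around the circle, counted with the product of their
slopes. -/
def flowCount (P : Γ.V → ℝ) (ℓ : ℝ) (d : ℕ) : ℚ :=
  ∑ᶠ a ∈ flows P ℓ d, ∏ e, ((a e).1.natAbs : ℚ)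

lemma norm_expTwoPi_pow_le_norm_flowTerm {a : Γ.E → ℤ × ℤ} (ha : a ∈ flows P ℓ d) :
    ‖expTwoPi τ‖ ^ d ≤ ‖flowTerm τ a‖ := by
  rw [flowTerm, norm_mul, ha.2, zpow_natCast, norm_pow, norm_prod]
  refine le_mul_of_one_le_left (by positivity) ?_
  simp_rw [Complex.norm_natCast]
  exact_mod_cast Finset.prod_pos fun e _ => Int.natAbs_pos.2 (ha.1.fst_ne_zero e)

lemma finite_flows (hΓ : Γ.Trivalent) (hℓ : 0 < ℓ) (hP : Function.Injective P)
    (hP' : ∀ v w, |P v - P w| < ℓ) (d : ℕ) : (flows P ℓ d).Finite := by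
  classical
  -- For `τ = iℓ` the terms of these flows in a convergent series are bounded from below.
  let τ : UpperHalfPlane := ⟨ℓ * Complex.I, by simpa using hℓ⟩
  have im_τ : τ.im = ℓ := by simp [τ, UpperHalfPlane.im]
  have pow_pos : 0 < ‖expTwoPi τ‖ ^ d := pow_pos (norm_pos_iff.2 (Complex.exp_ne_zero _)) d
  have eventually_lt := (summable_norm_flowTerm (τ := τ) hΓ hP
    (by rwa [im_τ])).tendsto_cofinite_zero.eventually (gt_mem_nhds pow_pos)
  refine (Filter.eventually_cofinite.1 eventually_lt).subset fun a ha => ?_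
  rw [Set.mem_ofPred_eq, im_τ, if_pos ha.1, not_lt]
  exact norm_expTwoPi_pow_le_norm_flowTerm ha

open Classical in
lemma tsum_ite_mem_flows (hfin : (flows P ℓ d).Finite) :
    ∑' a, (if a ∈ flows P ℓ d then flowTerm τ a else 0) = flowCount P ℓ d * expTwoPi τ ^ d := by
  rw [flowCount, finsum_mem_eq_finite_toFinset_sum _ hfin,
    tsum_eq_sum (s := hfin.toFinset) (by simp +contextual), Rat.cast_sum, Finset.sum_mul]
  refine Finset.sum_congr rfl fun a ha => ?_
  rw [Set.Finite.mem_toFinset] at ha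
  rw [if_pos ha, flowTerm, ha.2, zpow_natCast]
  push_cast
  rfl

lemma hasSum_flowCount [Nonempty Γ.E] (hΓ : Γ.Trivalent) (hℓ : 0 < ℓ)
    (hP' : ∀ v w, |P v - P w| < ℓ) (hy : Function.Injective y)
    (hy' : ∀ v w, |y v - y w| < τ.im) (lt_iff : ∀ v w, y v < y w ↔ P v < P w) :
    HasSum (fun d : ℕ => (flowCount P ℓ d : ℂ) * expTwoPi τ ^ d) (feynmanIntegral Γ y τ) := by
  classical
  have hP : Function.Injective P := fun v w h => by
    refine hy (le_antisymm (le_of_not_gt ?_) (le_of_not_gt ?_)) <;> simp [lt_iff, h]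
  have by_degree := (hasSum_feynmanIntegral hΓ hy hy').tsum_fiberwise fun a => (turns a).toNat
  refine by_degree.congr_fun fun d => ?_
  have mem_iff (a : Γ.E → ℤ × ℤ) :
      a ∈ flows P ℓ d ↔ (turns a).toNat = d ∧ IsFlow y τ.im a := by
    rw [isFlow_congr hy' hP' lt_iff, and_comm]
    refine and_congr_right fun ha => ?_
    have := ha.turns_pos hℓ
    omega
  rw [← tsum_ite_mem_flows (finite_flows hΓ hℓ hP hP' d), tsum_subtype
    ((fun a => (turns a).toNat) ⁻¹' {d}) fun a => if IsFlow y τ.im a then flowTerm τ a else 0]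
  refine tsum_congr fun a => ?_
  simp only [mem_iff, Set.indicator_apply, Set.mem_preimage, Set.mem_singleton_iff, ite_and]

lemma flowCount_zero [Nonempty Γ.E] (hℓ : 0 < ℓ) : flowCount P ℓ 0 = 0 := by
  have : flows P ℓ 0 = ∅ :=
    Set.eq_empty_of_forall_notMem fun a ha => ((ha.1.turns_pos hℓ).trans_eq ha.2).false
  rw [flowCount, this, finsum_mem_empty]

end FlowCount

section Degree

variable {ℓ : ℝ}

lemma coe_addCircle_eq_iff {a b : ℝ} :
    (a : AddCircle ℓ) = b ↔ ∃ n : ℤ, a = b + n * ℓ := by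
  rw [← sub_eq_zero, ← AddCircle.coe_sub, AddCircle.coe_eq_zero_iff]
  exact exists_congr fun n => by rw [zsmul_eq_mul, eq_comm, sub_eq_iff_eq_add']

lemma infinite_addCircle (hℓ : 0 < ℓ) : Infinite (AddCircle ℓ) := by
  have : Fact (0 < ℓ) := ⟨hℓ⟩
  have : Infinite (Set.Ico (0 : ℝ) (0 + ℓ)) := (Set.Ico_infinite (by simpa using hℓ)).to_subtype
  exact .of_injective _ (AddCircle.equivIco ℓ 0).symm.injective

lemma ncard_setOf_intCast_mem_Ioo {a b : ℝ} (ha : ∀ k : ℤ, a ≠ k) (hab : a ≤ b) :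
    ({k : ℤ | (k : ℝ) ∈ Set.Ioo a b}.ncard : ℤ) = ⌈b⌉ - ⌈a⌉ := by
  have : {k : ℤ | (k : ℝ) ∈ Set.Ioo a b} = (Finset.Ico ⌈a⌉ ⌈b⌉ : Set ℤ) := by
    rw [Finset.coe_Ico, ← Int.preimage_Ico]
    exact Set.ext fun k => and_congr_left fun _ => ⟨le_of_lt, fun h => h.lt_of_ne (ha k)⟩
  rw [this, Set.ncard_coe_finset, Int.card_Ico,
    Int.toNat_of_nonneg (sub_nonneg.2 (Int.ceil_le_ceil hab))]

/-- The coordinates `t` of the interior points of a segment of length `L` that are mapped to `X`, if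
the segment is mapped to the circle by `t ↦ α + s t`. -/
def preimages (ℓ L α s X : ℝ) : Set ℝ :=
  {t | t ∈ Set.Ioo 0 L ∧ ((α + s * t : ℝ) : AddCircle ℓ) = X}

lemma ncard_preimages_of_pos {L α s X : ℝ} (hℓ : 0 < ℓ) (hL : 0 < L) (hs : 0 < s)
    (hα : (α : AddCircle ℓ) ≠ X) :
    ((preimages ℓ L α s X).ncard : ℤ) = ⌈(α + s * L - X) / ℓ⌉ - ⌈(α - X) / ℓ⌉ := by
  have preimages_eq : preimages ℓ L α s X = (fun k : ℤ => (X + k * ℓ - α) / s) ''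
      {k : ℤ | (k : ℝ) ∈ Set.Ioo ((α - X) / ℓ) ((α + s * L - X) / ℓ)} := by
    ext t
    simp only [preimages, Set.mem_ofPred_eq, Set.mem_image, coe_addCircle_eq_iff, Set.mem_Ioo,
      div_lt_iff₀ hℓ, lt_div_iff₀ hℓ]
    constructor
    · rintro ⟨⟨t_pos, t_lt⟩, k, hk⟩
      exact ⟨k, ⟨by nlinarith, by nlinarith⟩, by rw [← hk]; field_simp; ring⟩
    · rintro ⟨k, ⟨lt_k, k_lt⟩, rfl⟩
      exact ⟨⟨by apply div_pos <;> linarith, by rw [div_lt_iff₀ hs]; linarith⟩, k,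
        by field_simp; ring⟩
  have injective : Function.Injective fun k : ℤ => (X + k * ℓ - α) / s := fun k k' h => by
    simpa [hs.ne', hℓ.ne'] using h
  rw [preimages_eq, Set.ncard_image_of_injective _ injective]
  refine ncard_setOf_intCast_mem_Ioo (fun k hk => hα (coe_addCircle_eq_iff.2 ⟨k, ?_⟩)) ?_
  · rw [← hk]
    field_simp
    ring
  · gcongr
    linarith [mul_pos hs hL]

lemma ncard_preimages_neg (L α s X : ℝ) :
    (preimages ℓ L (α + s * L) (-s) X).ncard = (preimages ℓ L α s X).ncard := by
  have : preimages ℓ L (α + s * L) (-s) X = (L - ·) ⁻¹' preimages ℓ L α s X := by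
    ext t
    have point_eq : α + s * L + -s * t = α + s * (L - t) := by ring
    simp only [preimages, Set.mem_preimage, Set.mem_ofPred_eq, Set.mem_Ioo, sub_pos,
      sub_lt_self_iff, and_comm (a := t < L), point_eq]
  rw [this, Set.ncard_preimage_of_injective_subset_range sub_right_injective]
  exact fun t _ => ⟨L - t, sub_sub_cancel L t⟩

lemma ncard_preimages_mul_natAbs {L α β X : ℝ} {s n : ℤ} (hℓ : 0 < ℓ) (hL : 0 < L)
    (hα : (α : AddCircle ℓ) ≠ X) (hβ : (β : AddCircle ℓ) ≠ X) (h : β - α + n * ℓ = s * L) :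
    ((preimages ℓ L α s X).ncard * s.natAbs : ℤ) =
      s * n + s * (⌈(β - X) / ℓ⌉ - ⌈(α - X) / ℓ⌉) := by
  have endpoint : α + s * L = β + n * ℓ := by
    rw [← h]
    ring
  have hβ' : ((α + s * L : ℝ) : AddCircle ℓ) ≠ X := by
    rwa [coe_addCircle_eq_iff.2 ⟨n, endpoint⟩]
  have ceil_endpoint : ⌈(α + s * L - X) / ℓ⌉ = ⌈(β - X) / ℓ⌉ + n := by
    rw [endpoint, ← Int.ceil_add_intCast]
    congr 1
    field_simp
    ring
  rcases lt_trichotomy s 0 with hs | rfl | hs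
  · have count := ncard_preimages_of_pos (s := -s) hℓ hL (by simpa using hs) hβ'
    rw [neg_mul, add_neg_cancel_right, ncard_preimages_neg, ceil_endpoint] at count
    rw [count, Int.ofNat_natAbs_of_nonpos hs.le]
    ring
  · simp
  · rw [ncard_preimages_of_pos hℓ hL (by exact_mod_cast hs) hα, ceil_endpoint,
      Int.natAbs_of_nonneg hs.le]
    ring

end Degree

namespace PreCover

open Multigraph

variable {ℓ : ℝ} (π : PreCover ℓ)

open Classical in
lemma excess_slope (v : π.C.V) : excess π.slope v =
    ((∑ x : π.C.E × Bool with π.C.ends x.1 x.2 = v ∧ 0 < π.raySlope x.1 x.2, π.weight x.1 : ℕ) :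
      ℤ) -
    (∑ x : π.C.E × Bool with π.C.ends x.1 x.2 = v ∧ π.raySlope x.1 x.2 < 0, π.weight x.1 : ℕ) := by
  push_cast
  rw [excess, ← Finset.filter_filter, ← Finset.filter_filter,
    Finset.sum_filter (p := fun x => 0 < _), Finset.sum_filter (p := fun x => _ < 0),
    ← Finset.sum_sub_distrib]
  refine Finset.sum_congr rfl fun ⟨e, b⟩ _ => ?_
  have weight_eq : (π.weight e : ℤ) = |π.raySlope e b| := by
    cases b <;> simp [weight, raySlope]
  have halfFlow_eq : halfFlow π.slope (e, b) = π.raySlope e b := rfl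
  rw [weight_eq, halfFlow_eq]
  rcases lt_trichotomy (π.raySlope e b) 0 with h | h | h
  · rw [if_neg h.not_gt, if_pos h, abs_of_neg h, zero_sub, neg_neg]
  · simp [h]
  · rw [if_pos h, if_neg h.not_gt, abs_of_pos h, sub_zero]

lemma balanced_iff : π.Balanced ↔ ∀ v, excess π.slope v = 0 := by
  exact forall_congr' fun v => by rw [excess_slope, sub_eq_zero, Nat.cast_inj, eq_comm]

/-- `P` lifts the images of the vertices to `ℝ`, and `a` consists of the slopes and the winding
numbers of the edges with respect to `P`. -/
structure IsLift (P : π.C.V → ℝ) (a : π.C.E → ℤ × ℤ) : Prop where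
  vmap_eq : ∀ v, π.vmap v = P v
  fst_eq : ∀ e, (a e).1 = π.slope e
  displacement_eq : ∀ e, displacement P ℓ a e = π.slope e * π.C.length e

variable {π} in
lemma IsLift.hasDegree_iff (hℓ : 0 < ℓ) {P : π.C.V → ℝ} {a : π.C.E → ℤ × ℤ} (h : π.IsLift P a)
    (hb : π.Balanced) {d : ℕ} : π.HasDegree d ↔ turns a = d := by
  have preimages_eq (e) (X : ℝ) : {t | t ∈ Set.Ioo 0 (π.C.length e) ∧ π.edgeMap e t = X} =
      preimages ℓ (π.C.length e) (P (π.C.ends e false)) (π.slope e) X := by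
    simp only [preimages, edgeMap, h.vmap_eq, AddCircle.coe_add]
  have count (X : ℝ) (hX : ∀ v, π.vmap v ≠ X) :
      ((∑ e, Set.ncard {t : ℝ | t ∈ Set.Ioo 0 (π.C.length e) ∧ π.edgeMap e t = X} *
        π.weight e : ℕ) : ℤ) = turns a := by
    have summand (e) : (Set.ncard {t | t ∈ Set.Ioo 0 (π.C.length e) ∧ π.edgeMap e t = X} *
        π.weight e : ℤ) = (a e).1 * (a e).2 + π.slope e • (⌈(P (π.C.ends e true) - X) / ℓ⌉ -
          ⌈(P (π.C.ends e false) - X) / ℓ⌉) := by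
      rw [preimages_eq, weight, smul_eq_mul, h.fst_eq]
      exact ncard_preimages_mul_natAbs hℓ (π.C.length_pos e) (h.vmap_eq _ ▸ hX _)
        (h.vmap_eq _ ▸ hX _) (h.displacement_eq e)
    push_cast
    rw [Finset.sum_congr rfl fun e _ => summand e, Finset.sum_add_distrib,
      sum_smul_sub_eq_zero (π.balanced_iff.1 hb) fun v => ⌈(P v - X) / ℓ⌉, add_zero, turns]
  constructor
  · intro hdeg
    have := infinite_addCircle hℓ
    obtain ⟨x, hx⟩ := (Set.finite_range π.vmap).infinite_compl.nonempty
    obtain ⟨X, rfl⟩ := QuotientAddGroup.mk_surjective x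
    have hX (v) : π.vmap v ≠ X := fun hv => hx ⟨v, hv⟩
    rw [← count X hX, hdeg _ hX]
  · intro hturns x hx
    obtain ⟨X, rfl⟩ := QuotientAddGroup.mk_surjective x
    exact_mod_cast (count X hx).trans hturns

end PreCover

namespace Multigraph

variable {G G' G'' : Multigraph}

namespace Iso

lemma trans_right_injective (φ : Iso G G') :
    Function.Injective fun ψ : Iso G' G'' => φ.trans ψ := by
  intro ψ ψ' h
  obtain ⟨vert_eq, edge_eq, flip_eq⟩ := Iso.ext_iff.1 h
  refine Iso.ext ?_ ?_ (funext fun e => ?_)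
  · exact Equiv.ext (φ.vert.surjective.forall.2 (DFunLike.congr_fun vert_eq))
  · exact Equiv.ext (φ.edge.surjective.forall.2 (DFunLike.congr_fun edge_eq))
  · obtain ⟨e, rfl⟩ := φ.edge.surjective e
    exact Bool.xor_right_inj.1 (congrFun flip_eq e)

instance : Finite (Iso G G') := by
  classical
  refine Finite.of_injective (fun φ : Iso G G' => (φ.vert, φ.edge, φ.flip)) fun φ ψ h => ?_
  simp only [Prod.mk.injEq] at h
  exact Iso.ext h.1 h.2.1 h.2.2

/-- The pull-back along an isomorphism of data on the edges that change sign with the reference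
direction of an edge. -/
def pull {A : Type*} [Neg A] (φ : Iso G G') (s : G'.E → A) (e : G.E) : A :=
  if φ.flip e then -s (φ.edge e) else s (φ.edge e)

lemma excess_pull {A : Type*} [AddCommGroup A] (φ : Iso G G') (s : G'.E → A) (v : G.V) :
    excess (φ.pull s) v = excess s (φ.vert v) := by
  classical
  unfold excess
  refine Finset.sum_bij' (fun x _ => (φ.edge x.1, xor x.2 (φ.flip x.1)))
    (fun x _ => (φ.edge.symm x.1, xor x.2 (φ.flip (φ.edge.symm x.1)))) ?_ ?_ (by simp) (by simp) ?_
  · intro x hx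
    simpa only [Finset.mem_filter, Finset.mem_univ, true_and, φ.ends_eq, φ.vert.apply_eq_iff_eq]
      using hx
  · intro x hx
    simp only [Finset.mem_filter, Finset.mem_univ, true_and] at hx ⊢
    rw [← φ.vert.apply_eq_iff_eq, ← φ.ends_eq, ← hx]
    simp
  · rintro ⟨e, b⟩ _
    simp only [halfFlow, pull]
    cases b <;> cases φ.flip e <;> simp

lemma turns_pull (φ : Iso G G') (a : G'.E → ℤ × ℤ) : turns (φ.pull a) = turns a := by
  refine Fintype.sum_equiv φ.edge _ _ fun e => ?_
  unfold pull
  split_ifs <;> simp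

lemma fst_pull (φ : Iso G G') (a : G'.E → ℤ × ℤ) (e : G.E) :
    (φ.pull a e).1 = φ.pull (fun e => (a e).1) e := by
  unfold pull
  split_ifs <;> rfl

lemma displacement_pull (φ : Iso G G') (P : G'.V → ℝ) (ℓ : ℝ) (a : G'.E → ℤ × ℤ) (e : G.E) :
    displacement (fun v => P (φ.vert v)) ℓ (φ.pull a) e = φ.pull (displacement P ℓ a) e := by
  simp only [displacement, pull, ← φ.ends_eq]
  split_ifs with hflip
  · simp only [hflip, Bool.xor_true, Bool.not_true, Bool.not_false, Prod.snd_neg, Int.cast_neg]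
    ring
  · simp [hflip]

lemma isFlow_pull (φ : Iso G G') {P : G'.V → ℝ} {ℓ : ℝ} {a : G'.E → ℤ × ℤ} (ha : IsFlow P ℓ a) :
    IsFlow (fun v => P (φ.vert v)) ℓ (φ.pull a) := by
  constructor
  · simp only [fst_pull, excess_pull]
    exact fun v => ha.1 _
  · intro e
    rw [displacement_pull]
    have pos := ha.2 (φ.edge e)
    unfold pull
    split_ifs
    · simpa using pos
    · exact pos

end Iso

lemma Trivalent.exists_ends_eq (hG : G.Trivalent) (v : G.V) : ∃ e b, G.ends e b = v := by
  have card_ne_zero : Nat.card {x : G.E × Bool // G.ends x.1 x.2 = v} ≠ 0 := by simp [hG v]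
  obtain ⟨⟨⟨e, b⟩, hv⟩⟩ := (Nat.card_ne_zero.1 card_ne_zero).1
  exact ⟨e, b, hv⟩

lemma Connected.nonempty_edge (hc : G.Connected) (ht : G.Trivalent) : Nonempty G.E :=
  let ⟨e, _⟩ := ht.exists_ends_eq hc.1.some
  ⟨e⟩

end Multigraph

open Topology in
lemma eq_of_forall_coe_mul_eq {ℓ L x y : ℝ} (hℓ : 0 < ℓ) (hL : 0 < L)
    (h : ∀ t ∈ Set.Icc 0 L, ((x * t : ℝ) : AddCircle ℓ) = ((y * t : ℝ) : AddCircle ℓ)) :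
    x = y := by
  have small : ∀ᶠ t in 𝓝[>] (0 : ℝ), |(x - y) * t| < ℓ :=
    ((Continuous.tendsto' (by fun_prop) 0 0 (by simp)).eventually_lt_const hℓ).filter_mono
      nhdsWithin_le_nhds
  obtain ⟨t, t_small, t_pos, t_le⟩ := (small.and (Ioc_mem_nhdsGT hL)).exists
  obtain ⟨k, hk⟩ := coe_addCircle_eq_iff.1 (h t ⟨t_pos.le, t_le⟩)
  have mul_eq : (x - y) * t = k * ℓ := by linarith
  have k_eq_zero : k = 0 := by
    rw [mul_eq, abs_mul, abs_of_pos hℓ, mul_lt_iff_lt_one_left hℓ] at t_small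
    exact Int.abs_lt_one_iff.1 (by exact_mod_cast t_small)
  rw [k_eq_zero, Int.cast_zero, zero_mul, mul_eq_zero] at mul_eq
  exact sub_eq_zero.1 (mul_eq.resolve_right t_pos.ne')

lemma PreCover.edgeMap_flipCoord {ℓ : ℝ} (π : PreCover ℓ) (e : π.C.E) (b : Bool) (t : ℝ) :
    π.edgeMap e (flipCoord b (π.C.length e) t) =
      π.vmap (π.C.ends e b) + ((π.raySlope e b * t : ℝ) : AddCircle ℓ) := by
  cases b
  · simp [edgeMap, flipCoord, raySlope]
  · simp only [edgeMap, flipCoord, raySlope, if_true, π.continuous_eq e, add_assoc,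
      ← AddCircle.coe_add]
    congr 2
    push_cast
    ring

namespace TropicalCover

namespace Iso

variable {ℓ : ℝ} {π π' π'' : TropicalCover ℓ}

lemma toIso_injective : Function.Injective fun φ : Iso π π' => φ.toIso := by
  rintro ⟨⟨φ, _⟩, _⟩ ⟨⟨ψ, _⟩, _⟩ (rfl : φ = ψ)
  rfl

instance : Finite (Iso π π') := Finite.of_injective _ toIso_injective

lemma trans_right_injective (φ : Iso π π') :
    Function.Injective fun ψ : Iso π' π'' => φ.trans ψ := fun _ _ h =>
  toIso_injective (φ.toIso.trans_right_injective (congrArg (·.toIso) h))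

lemma card_eq (φ : Iso π π') : Nat.card (Iso π π'') = Nat.card (Iso π' π'') :=
  le_antisymm (Nat.card_le_card_of_injective _ φ.symm.trans_right_injective)
    (Nat.card_le_card_of_injective _ φ.trans_right_injective)

lemma vmap_eq (φ : Iso π π') (v : π.C.V) : π'.vmap (φ.vert v) = π.vmap v := by
  obtain ⟨e, b, rfl⟩ := π.C.trivalent.exists_ends_eq v
  have mem : flipCoord b (π.C.length e) 0 ∈ Set.Icc 0 (π.C.length e) := by
    cases b <;> simp [flipCoord, (π.C.length_pos e).le]
  have flip_flip : flipCoord (φ.flip e) (π.C.length e) (flipCoord b (π.C.length e) 0) =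
      flipCoord (xor b (φ.flip e)) (π'.C.length (φ.edge e)) 0 := by
    rw [φ.length_eq]
    cases b <;> cases φ.flip e <;> simp [flipCoord]
  have map_eq := φ.map_eq e _ mem
  rw [flip_flip, PreCover.edgeMap_flipCoord, PreCover.edgeMap_flipCoord, φ.ends_eq] at map_eq
  simpa using map_eq

lemma slope_eq (hℓ : 0 < ℓ) (φ : Iso π π') (e : π.C.E) : π.slope e = φ.pull π'.slope e := by
  have cast_eq : (π.slope e : ℝ) = π'.raySlope (φ.edge e) (φ.flip e) := by
    refine eq_of_forall_coe_mul_eq hℓ (π.C.length_pos e) fun t ht => ?_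
    have map_eq := φ.map_eq e t ht
    have ends_eq := φ.ends_eq e false
    rw [Bool.false_xor] at ends_eq
    rw [← φ.length_eq, PreCover.edgeMap_flipCoord, ends_eq, φ.vmap_eq] at map_eq
    exact (add_left_cancel map_eq).symm
  exact_mod_cast cast_eq

lemma prod_weight_eq (hℓ : 0 < ℓ) (φ : Iso π π') :
    ∏ e, (π.weight e : ℚ) = ∏ e, (π'.weight e : ℚ) := by
  refine Fintype.prod_equiv φ.edge _ _ fun e => ?_
  rw [PreCover.weight, PreCover.weight, φ.slope_eq hℓ, Multigraph.Iso.pull]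
  split_ifs <;> simp

/-- The isomorphism of covers given by an isomorphism of the source graphs that is compatible with
the lengths of the edges, the images of the vertices and the slopes. -/
def ofGraphIso (φ : Multigraph.Iso π.C.toMultigraph π'.C.toMultigraph)
    (length_eq : ∀ e, π'.C.length (φ.edge e) = π.C.length e)
    (vmap_eq : ∀ v, π'.vmap (φ.vert v) = π.vmap v)
    (slope_eq : ∀ e, π.slope e = φ.pull π'.slope e) : Iso π π' where
  toIso := φ
  length_eq := length_eq
  map_eq e t _ := by
    have ends_eq := φ.ends_eq e false
    rw [Bool.false_xor] at ends_eq
    rw [← length_eq, PreCover.edgeMap_flipCoord, ends_eq, vmap_eq, PreCover.edgeMap, slope_eq]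
    rfl

end Iso

end TropicalCover

namespace PreCover

open Multigraph

variable {ℓ : ℝ} {π : PreCover ℓ} {P : π.C.V → ℝ} {a b : π.C.E → ℤ × ℤ}

lemma exists_isLift (hP : ∀ v, π.vmap v = P v) : ∃ a, π.IsLift P a := by
  have winding (e : π.C.E) :
      ∃ n : ℤ, P (π.C.ends e true) - P (π.C.ends e false) + n * ℓ = π.slope e * π.C.length e := by
    have continuous_eq := π.continuous_eq e
    rw [hP, hP, ← AddCircle.coe_add, eq_comm, coe_addCircle_eq_iff] at continuous_eq
    obtain ⟨n, hn⟩ := continuous_eq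
    exact ⟨n, by linarith⟩
  choose n hn using winding
  exact ⟨fun e => (π.slope e, n e), hP, fun _ => rfl, hn⟩

lemma IsLift.unique (hℓ : ℓ ≠ 0) (ha : π.IsLift P a) (hb : π.IsLift P b) : a = b := by
  funext e
  have displacement_eq := (ha.displacement_eq e).trans (hb.displacement_eq e).symm
  refine Prod.ext ((ha.fst_eq e).trans (hb.fst_eq e).symm) ?_
  simpa [displacement, hℓ] using displacement_eq

lemma slope_ne_zero (hπ : Function.Injective π.vmap) (hb : π.Balanced) (e : π.C.E) :
    π.slope e ≠ 0 := by
  have of_ends_ne (e) (he : π.C.ends e false ≠ π.C.ends e true) : π.slope e ≠ 0 := by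
    intro slope_eq_zero
    refine he (hπ ?_)
    simp [π.continuous_eq e, slope_eq_zero]
  exact of_ends_ne e
    (ends_ne_of_excess_eq_zero π.C.trivalent (π.balanced_iff.1 hb) of_ends_ne e)

lemma IsLift.fst_pull (h : π.IsLift P a) {G : Multigraph} (ψ : Iso G π.C.toMultigraph) (e : G.E) :
    (ψ.pull a e).1 = ψ.pull π.slope e := by
  simp only [Iso.fst_pull, h.fst_eq]

lemma IsLift.displacement_pull (h : π.IsLift P a) {G : Multigraph} (ψ : Iso G π.C.toMultigraph)
    (e : G.E) : displacement (fun v => P (ψ.vert v)) ℓ (ψ.pull a) e =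
      (ψ.pull a e).1 * π.C.length (ψ.edge e) := by
  rw [Iso.displacement_pull, h.fst_pull, Iso.pull, Iso.pull, h.displacement_eq]
  split_ifs <;> simp

lemma IsLift.isFlow (h : π.IsLift P a) (hπ : Function.Injective π.vmap) (hb : π.Balanced) :
    IsFlow P ℓ a := by
  constructor
  · simpa only [h.fst_eq] using π.balanced_iff.1 hb
  · intro e
    have cast_ne_zero : (π.slope e : ℝ) ≠ 0 := Int.cast_ne_zero.2 (slope_ne_zero hπ hb e)
    rw [h.displacement_eq, h.fst_eq, ← mul_assoc]
    exact mul_pos (mul_self_pos.2 cast_ne_zero) (π.C.length_pos e)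

end PreCover

section CoverOfFlow

open Multigraph

variable {Γ : Multigraph} {P : Γ.V → ℝ} {ℓ : ℝ} {a : Γ.E → ℤ × ℤ}

/-- The cover given by a flow on a graph whose vertices are placed at `P`. -/
def coverOfFlow (hc : Γ.Connected) (ht : Γ.Trivalent) (ha : IsFlow P ℓ a) : TropicalCover ℓ where
  C :=
    { toMultigraph := Γ
      connected := hc
      trivalent := ht
      length := fun e => displacement P ℓ a e / (a e).1
      length_pos := fun e => by
        rw [div_pos_iff, or_congr and_comm and_comm, ← mul_pos_iff]
        exact ha.2 e }
  vmap v := P v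
  slope e := (a e).1
  continuous_eq e := by
    have cast_ne_zero : ((a e).1 : ℝ) ≠ 0 := Int.cast_ne_zero.2 (ha.fst_ne_zero e)
    simp only [mul_div_cancel₀ _ cast_ne_zero]
    rw [← AddCircle.coe_add, coe_addCircle_eq_iff]
    exact ⟨-(a e).2, by rw [displacement]; push_cast; ring⟩
  nonConstant := ⟨(hc.nonempty_edge ht).some, ha.fst_ne_zero _⟩
  balanced := (PreCover.balanced_iff _).2 ha.1

lemma isLift_coverOfFlow (hc : Γ.Connected) (ht : Γ.Trivalent) (ha : IsFlow P ℓ a) :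
    (coverOfFlow hc ht ha).IsLift P a where
  vmap_eq _ := rfl
  fst_eq _ := rfl
  displacement_eq e :=
    (mul_div_cancel₀ _ (Int.cast_ne_zero.2 (ha.fst_ne_zero e))).symm

end CoverOfFlow

namespace TropicalCover.Iso

open Multigraph

variable {ℓ : ℝ} {π π' : TropicalCover ℓ} {P : π'.C.V → ℝ} {b : π'.C.E → ℤ × ℤ}

lemma isLift_pull (hℓ : 0 < ℓ) (φ : Iso π π') (h : π'.IsLift P b) :
    π.IsLift (fun v => P (φ.vert v)) (φ.pull b) where
  vmap_eq v := by rw [← φ.vmap_eq, h.vmap_eq]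
  fst_eq e := by rw [h.fst_pull, φ.slope_eq hℓ]
  displacement_eq e := by rw [h.displacement_pull, h.fst_pull, φ.length_eq, ← φ.slope_eq hℓ]

/-- The isomorphism of covers given by an isomorphism `ψ` from a graph to the source of a cover, if
the graph carries the flow that is the pull-back along `ψ` of a lift of the cover. -/
def ofIsLift {G : Multigraph} (hc : G.Connected) (ht : G.Trivalent)
    (ψ : Multigraph.Iso G π'.C.toMultigraph) (h : π'.IsLift P b)
    (flow : IsFlow (fun v => P (ψ.vert v)) ℓ (ψ.pull b)) :
    Iso (coverOfFlow hc ht flow) π' :=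
  ofGraphIso (π := coverOfFlow hc ht flow) ψ
    (fun e => ((div_eq_iff (Int.cast_ne_zero.2 (flow.fst_ne_zero e))).2
      ((h.displacement_pull ψ e).trans (mul_comm _ _))).symm)
    (fun _ => h.vmap_eq _) (fun e => h.fst_pull ψ e)

end TropicalCover.Iso

lemma exists_equiv_of_range_eq {α β γ : Type*} [Finite α] [Finite β] {f : α → γ} {p : β → γ}
    (hp : Function.Injective p) (hrange : Set.range f = Set.range p)
    (hcard : Nat.card α = Nat.card β) : ∃ e : α ≃ β, ∀ x, p (e x) = f x := by
  have lift (x : α) : ∃ y, p y = f x := hrange.subset ⟨x, rfl⟩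
  choose e he using lift
  have surjective : Function.Surjective e := fun y => by
    obtain ⟨x, hx⟩ := hrange.superset ⟨y, rfl⟩
    exact ⟨x, hp ((he x).trans hx)⟩
  exact ⟨.ofBijective e (surjective.bijective_of_nat_card_le hcard.le), he⟩

namespace Multigraph

variable {G : Multigraph} {g : ℕ}

lemma Trivalent.three_mul_card_eq (hG : G.Trivalent) :
    3 * Fintype.card G.V = 2 * Fintype.card G.E := by
  classical
  have by_fiber := Nat.card_congr (Equiv.sigmaFiberEquiv fun x : G.E × Bool => G.ends x.1 x.2)
  rw [Nat.card_sigma, Finset.sum_congr rfl fun v _ => hG v] at by_fiber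
  simpa [mul_comm] using by_fiber

lemma card_vert_of_genus_eq (hG : G.Trivalent) (hg : G.genus = g) :
    Fintype.card G.V = 2 * g - 2 := by
  have := hG.three_mul_card_eq
  unfold genus at hg
  omega

lemma card_edge_of_genus_eq (hG : G.Trivalent) (hg : G.genus = g) :
    Fintype.card G.E = 3 * g - 3 := by
  have := hG.three_mul_card_eq
  unfold genus at hg
  omega

end Multigraph

section Marking

open Multigraph

variable {g : ℕ}

lemma FeynmanGraph.card_vert (Γ : FeynmanGraph g) : Fintype.card Γ.1.V = 2 * g - 2 :=
  card_vert_of_genus_eq Γ.2.2.1 Γ.2.2.2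

/-- The vertices placed at the numbers `r`, in the order `Ω`. -/
def position (Γ : FeynmanGraph g) (r : Fin (2 * g - 2) → ℝ) (Ω : VertexOrder Γ.1) (v : Γ.1.V) : ℝ :=
  r (Fin.cast Γ.card_vert (Ω v))

/-- An order of the vertices and a flow that turns `d` times around the circle. -/
abbrev Marking (Γ : FeynmanGraph g) (r : Fin (2 * g - 2) → ℝ) (ℓ : ℝ) (d : ℕ) : Type :=
  Σ Ω : VertexOrder Γ.1, flows (position Γ r Ω) ℓ d

namespace Marking

variable {Γ : FeynmanGraph g} {r : Fin (2 * g - 2) → ℝ} {ℓ : ℝ} {d : ℕ} {x x' : Marking Γ r ℓ d}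
  {π : TropicalCover ℓ}

lemma ext (order_eq : x.1 = x'.1) (flow_eq : x.2.1 = x'.2.1) : x = x' := by
  obtain ⟨Ω, a, ha⟩ := x
  obtain ⟨Ω', a', ha'⟩ := x'
  obtain rfl : Ω = Ω' := order_eq
  obtain rfl : a = a' := flow_eq
  rfl

/-- The cover given by a marking. -/
def cover (x : Marking Γ r ℓ d) : TropicalCover ℓ := coverOfFlow Γ.2.1 Γ.2.2.1 x.2.2.1

lemma isLift_cover (x : Marking Γ r ℓ d) : x.cover.IsLift (position Γ r x.1) x.2.1 :=
  isLift_coverOfFlow Γ.2.1 Γ.2.2.1 x.2.2.1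

lemma hasDegree_cover (hℓ : 0 < ℓ) (x : Marking Γ r ℓ d) : x.cover.HasDegree d :=
  (x.isLift_cover.hasDegree_iff hℓ x.cover.balanced).2 x.2.2.2

lemma range_vmap_cover (x : Marking Γ r ℓ d) :
    Set.range x.cover.vmap = Set.range fun i => (r i : AddCircle ℓ) :=
  (x.1.trans (finCongr Γ.card_vert)).surjective.range_comp fun i => (r i : AddCircle ℓ)

/-- The isomorphism from `Γ` that underlies an isomorphism from the cover given by a marking. -/
def graphIso (φ : TropicalCover.Iso x.cover π) : Multigraph.Iso Γ.1 π.C.toMultigraph := φ.toIso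

lemma snd_eq_pull (hℓ : 0 < ℓ) (φ : TropicalCover.Iso x.cover π) {P : π.C.V → ℝ}
    {b : π.C.E → ℤ × ℤ} (h : π.IsLift P b)
    (hP : ∀ v, P ((graphIso φ).vert v) = position Γ r x.1 v) : x.2.1 = (graphIso φ).pull b := by
  have P_eq : (fun v => P (φ.vert v)) = position Γ r x.1 := funext hP
  have isLift_pull : x.cover.IsLift (position Γ r x.1) (φ.pull b) := P_eq ▸ φ.isLift_pull hℓ h
  exact x.isLift_cover.unique hℓ.ne' isLift_pull

lemma eq_of_graphIso_eq (hℓ : 0 < ℓ) (hr : Function.Injective fun i => (r i : AddCircle ℓ))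
    (φ : TropicalCover.Iso x.cover π) (φ' : TropicalCover.Iso x'.cover π)
    (h : graphIso φ = graphIso φ') : x = x' := by
  have position_eq (v) : (position Γ r x.1 v : AddCircle ℓ) = position Γ r x'.1 v :=
    (φ.vmap_eq v).symm.trans ((congrArg (fun ψ => π.vmap (ψ.vert v)) h).trans (φ'.vmap_eq v))
  have order_eq : x.1 = x'.1 :=
    Equiv.ext fun v => Fin.cast_injective Γ.card_vert (hr (position_eq v))
  have lift_apply (v) : π.vmap v = (position Γ r x.1 ((graphIso φ).vert.symm v) : ℝ) := by
    rw [← (graphIso φ).vert.apply_symm_apply v, Equiv.symm_apply_apply]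
    exact φ.vmap_eq _
  obtain ⟨b, hb⟩ := PreCover.exists_isLift lift_apply
  have snd_eq := snd_eq_pull hℓ φ hb (by simp)
  have snd_eq' := snd_eq_pull hℓ φ' hb (by simp [h, order_eq])
  rw [← h, ← snd_eq] at snd_eq'
  exact ext order_eq snd_eq'.symm

lemma exists_graphIso_eq (hℓ : 0 < ℓ) (hr : Function.Injective fun i => (r i : AddCircle ℓ))
    (hdeg : π.HasDegree d) (hrange : Set.range π.vmap = Set.range fun i => (r i : AddCircle ℓ))
    (ψ : Multigraph.Iso Γ.1 π.C.toMultigraph) :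
    ∃ (x : Marking Γ r ℓ d) (φ : TropicalCover.Iso x.cover π), graphIso φ = ψ := by
  have card_eq : Nat.card π.C.V = Nat.card (Fin (2 * g - 2)) := by
    rw [← Nat.card_congr ψ.vert, Nat.card_eq_fintype_card, Γ.card_vert, Nat.card_fin]
  obtain ⟨index, hindex⟩ := exists_equiv_of_range_eq hr hrange card_eq
  have vmap_injective : Function.Injective π.vmap := by
    rw [← funext hindex]
    exact hr.comp index.injective
  obtain ⟨b, hb⟩ := PreCover.exists_isLift (P := fun v => r (index v)) fun v => (hindex v).symm
  have flow := ψ.isFlow_pull (hb.isFlow vmap_injective π.balanced)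
  have turns_eq : turns (ψ.pull b) = d :=
    (ψ.turns_pull b).trans ((hb.hasDegree_iff hℓ π.balanced).1 hdeg)
  exact ⟨⟨(ψ.vert.trans index).trans (finCongr Γ.card_vert.symm), ψ.pull b, flow, turns_eq⟩,
    .ofIsLift Γ.2.1 Γ.2.2.1 ψ hb flow, rfl⟩

lemma bijective_graphIso (hℓ : 0 < ℓ) (hr : Function.Injective fun i => (r i : AddCircle ℓ))
    (hdeg : π.HasDegree d) (hrange : Set.range π.vmap = Set.range fun i => (r i : AddCircle ℓ)) :
    Function.Bijective fun z : Σ x : Marking Γ r ℓ d, TropicalCover.Iso x.cover π =>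
      graphIso z.2 := by
  constructor
  · rintro ⟨x, φ⟩ ⟨x', φ'⟩ h
    obtain rfl : x = x' := eq_of_graphIso_eq hℓ hr φ φ' h
    exact congrArg (Sigma.mk x) (TropicalCover.Iso.toIso_injective h)
  · intro ψ
    obtain ⟨x, φ, h⟩ := exists_graphIso_eq hℓ hr hdeg hrange ψ
    exact ⟨⟨x, φ⟩, h⟩

end Marking

end Marking

namespace Multigraph.Iso

variable {G G' G'' : Multigraph}

lemma card_eq (φ : Iso G G') : Nat.card (Iso G G'') = Nat.card (Iso G' G'') :=
  le_antisymm (Nat.card_le_card_of_injective _ φ.symm.trans_right_injective)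
    (Nat.card_le_card_of_injective _ φ.trans_right_injective)

lemma symm_symm (φ : Iso G G') : φ.symm.symm = φ := by
  refine Iso.ext rfl rfl (funext fun e => ?_)
  simp [symm]

lemma card_comm (G G' : Multigraph) : Nat.card (Iso G G') = Nat.card (Iso G' G) :=
  Nat.card_congr ⟨symm, symm, symm_symm, symm_symm⟩

end Multigraph.Iso

section FeynmanClass

variable {g : ℕ}

theorem finite_feynmanClass (g : ℕ) : Finite (FeynmanClass g) := by
  let labelV (c : FeynmanClass g) : (Quotient.out c).1.V ≃ Fin (2 * g - 2) :=
    Fintype.equivFinOfCardEq (Quotient.out c).card_vert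
  let labelE (c : FeynmanClass g) : (Quotient.out c).1.E ≃ Fin (3 * g - 3) :=
    Fintype.equivFinOfCardEq
      (Multigraph.card_edge_of_genus_eq (Quotient.out c).2.2.1 (Quotient.out c).2.2.2)
  refine Finite.of_injective (β := Fin (3 * g - 3) → Bool → Fin (2 * g - 2))
    (fun c e b => labelV c ((Quotient.out c).1.ends ((labelE c).symm e) b)) fun c c' h => ?_
  rw [← Quotient.out_eq c, ← Quotient.out_eq c']
  refine Quotient.sound
    ⟨⟨(labelV c).trans (labelV c').symm, (labelE c).trans (labelE c').symm, fun _ => false, ?_⟩⟩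
  intro e b
  have ends_eq := congrFun (congrFun h (labelE c e)) b
  simp only [Equiv.symm_apply_apply] at ends_eq
  simp [ends_eq]

/-- The isomorphism class of a Feynman graph. -/
def FeynmanGraph.toClass (Γ : FeynmanGraph g) : FeynmanClass g := Quotient.mk _ Γ

variable {ref : FeynmanClass g → FeynmanGraph g}

lemma nonempty_iso_ref_iff (href : ∀ c, (ref c).toClass = c) (γ : FeynmanClass g)
    (Γ : FeynmanGraph g) : Nonempty (Multigraph.Iso (ref γ).1 Γ.1) ↔ γ = Γ.toClass :=
  Quotient.eq.symm.trans (Eq.congr_left (href γ))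

lemma sum_card_iso_ref_div [Fintype (FeynmanClass g)] (href : ∀ c, (ref c).toClass = c)
    (Γ : FeynmanGraph g) :
    ∑ γ, (Nat.card (Multigraph.Iso (ref γ).1 Γ.1) : ℚ) /
      Nat.card (Multigraph.Iso (ref γ).1 (ref γ).1) = 1 := by
  refine (Fintype.sum_eq_single Γ.toClass fun γ hγ => ?_).trans ?_
  · rw [ne_eq, ← nonempty_iso_ref_iff href, not_nonempty_iff] at hγ
    rw [Nat.card_of_isEmpty, Nat.cast_zero, zero_div]
  · have nonempty := (nonempty_iso_ref_iff href Γ.toClass Γ).2 rfl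
    have card_eq : Nat.card (Multigraph.Iso (ref Γ.toClass).1 (ref Γ.toClass).1) =
        Nat.card (Multigraph.Iso (ref Γ.toClass).1 Γ.1) :=
      nonempty.some.card_eq.trans (Multigraph.Iso.card_comm _ _)
    rw [card_eq]
    exact div_self (Nat.cast_ne_zero.2 Nat.card_pos.ne')

end FeynmanClass

section SortedLift

variable {ℓ : ℝ} {N : ℕ} {p : Fin N → AddCircle ℓ} {r : Fin N → ℝ}

/-- The numbers `r` are lifts of the points of the circle in the family `p`, listed in increasing
order, to an interval shorter than the circle. -/
structure IsSortedLift (p : Fin N → AddCircle ℓ) (r : Fin N → ℝ) : Prop where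
  strictMono : StrictMono r
  abs_sub_lt : ∀ i j, |r i - r j| < ℓ
  range_eq : Set.range p = Set.range fun i => (r i : AddCircle ℓ)

lemma exists_isSortedLift (hℓ : 0 < ℓ) (hp : Function.Injective p) : ∃ r, IsSortedLift p r := by
  have : Fact (0 < ℓ) := ⟨hℓ⟩
  let P (i : Fin N) : ℝ := AddCircle.equivIco ℓ 0 (p i)
  have coe_P (i) : (P i : AddCircle ℓ) = p i := AddCircle.coe_equivIco
  have P_mem (i) : P i ∈ Set.Ico 0 ℓ := by simpa [P] using (AddCircle.equivIco ℓ 0 (p i)).2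
  have injective : Function.Injective P := fun i j h => hp (by rw [← coe_P, ← coe_P, h])
  refine ⟨P ∘ Tuple.sort P, ⟨(Tuple.monotone_sort P).strictMono_of_injective
    (injective.comp (Tuple.sort P).injective), fun i j => ?_, ?_⟩⟩
  · exact abs_sub_lt_of_nonneg_of_lt (P_mem _).1 (P_mem _).2 (P_mem _).1 (P_mem _).2
  · simp only [Function.comp_apply, coe_P]
    exact ((Tuple.sort P).surjective.range_comp p).symm

lemma IsSortedLift.coe_injective (h : IsSortedLift p r) :
    Function.Injective fun i => (r i : AddCircle ℓ) := by
  intro i j hij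
  obtain ⟨n, hn⟩ := coe_addCircle_eq_iff.1 hij
  have abs_lt := h.abs_sub_lt i j
  rw [hn, add_sub_cancel_left, abs_mul] at abs_lt
  have n_eq_zero : n = 0 := by
    by_contra hne
    have : (1 : ℝ) ≤ |(n : ℝ)| := by exact_mod_cast Int.one_le_abs hne
    nlinarith [le_abs_self ℓ, abs_nonneg ℓ]
  exact h.strictMono.injective (by simpa [n_eq_zero] using hn)

end SortedLift

section MarkingCount

variable {g d : ℕ} {Γ : FeynmanGraph g} {r : Fin (2 * g - 2) → ℝ} {ℓ : ℝ}
  {p : Fin (2 * g - 2) → AddCircle ℓ} {Ω : VertexOrder Γ.1} {τ : UpperHalfPlane}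

lemma IsSortedLift.injective_position (h : IsSortedLift p r) :
    Function.Injective (position Γ r Ω) :=
  h.strictMono.injective.comp ((Fin.cast_injective _).comp Ω.injective)

lemma IsSortedLift.finite_flows (hℓ : 0 < ℓ) (h : IsSortedLift p r) (Ω : VertexOrder Γ.1)
    (d : ℕ) : (flows (position Γ r Ω) ℓ d).Finite :=
  TropMirror.finite_flows Γ.2.2.1 hℓ h.injective_position (fun _ _ => h.abs_sub_lt _ _) d

lemma IsSortedLift.finite_marking (hℓ : 0 < ℓ) (h : IsSortedLift p r) :
    Finite (Marking Γ r ℓ d) := by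
  have (Ω : VertexOrder Γ.1) : Finite (flows (position Γ r Ω) ℓ d) := h.finite_flows hℓ Ω d
  infer_instance

lemma Admissible.strictMono {y : Γ.1.V → ℝ} (hy : Admissible Ω τ y) : StrictMono (y ∘ Ω.symm) :=
  fun _ _ hlt => hy.1 _ _ (by simpa using hlt)

lemma Admissible.lt_iff_position {y : Γ.1.V → ℝ} (hy : Admissible Ω τ y) (hr : StrictMono r)
    (v w : Γ.1.V) : y v < y w ↔ position Γ r Ω v < position Γ r Ω w := by
  rw [position, position, hr.lt_iff_lt, Fin.cast_lt_cast, ← hy.strictMono.lt_iff_lt]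
  simp

open Classical in
/-- The number of markings with `d` turns, counted with the product of the slopes. -/
def markingCount (Γ : FeynmanGraph g) (r : Fin (2 * g - 2) → ℝ) (ℓ : ℝ) (d : ℕ) : ℚ :=
  ∑ Ω : VertexOrder Γ.1, flowCount (position Γ r Ω) ℓ d

lemma hasSum_markingCount (hℓ : 0 < ℓ) (h : IsSortedLift p r) {y : VertexOrder Γ.1 → Γ.1.V → ℝ}
    (hy : ∀ Ω, Admissible Ω τ (y Ω)) :
    HasSum (fun d : ℕ => (markingCount Γ r ℓ d : ℂ) * expTwoPi τ ^ d) (feynmanSum Γ.1 y τ) := by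
  have := Γ.2.1.nonempty_edge Γ.2.2.1
  unfold feynmanSum markingCount
  simp only [Rat.cast_sum, Finset.sum_mul]
  exact hasSum_sum fun Ω _ => hasSum_flowCount Γ.2.2.1 hℓ (fun _ _ => h.abs_sub_lt _ _)
    ((Ω.symm.injective_comp _).1 (hy Ω).strictMono.injective) (hy Ω).2
    ((hy Ω).lt_iff_position h.strictMono)

lemma markingCount_zero (hℓ : 0 < ℓ) : markingCount Γ r ℓ 0 = 0 := by
  have := Γ.2.1.nonempty_edge Γ.2.2.1
  exact Finset.sum_eq_zero fun Ω _ => flowCount_zero hℓ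

lemma markingCount_eq_finsum (hℓ : 0 < ℓ) (h : IsSortedLift p r) :
    markingCount Γ r ℓ d = ∑ᶠ x : Marking Γ r ℓ d, ∏ e, (x.cover.weight e : ℚ) := by
  classical
  let (Ω : VertexOrder Γ.1) := (h.finite_flows hℓ Ω d).fintype
  rw [finsum_eq_sum_of_fintype, Fintype.sum_sigma]
  refine Finset.sum_congr (by congr!) fun Ω _ => ?_
  rw [flowCount, ← finsum_set_coe_eq_finsum_mem, finsum_eq_sum_of_fintype]
  rfl

end MarkingCount

section Hurwitz

variable {g d : ℕ} {Γ : FeynmanGraph g} {r : Fin (2 * g - 2) → ℝ} {ℓ : ℝ}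
  {p : Fin (2 * g - 2) → AddCircle ℓ} {ref : FeynmanClass g → FeynmanGraph g}

namespace Marking

/-- The isomorphism class of the cover given by a marking. -/
def toClass (hℓ : 0 < ℓ) (h : IsSortedLift p r) (x : Marking Γ r ℓ d) : CoverClass ℓ g p d :=
  Quotient.mk _
    ⟨x.cover, Γ.2.2.2, x.hasDegree_cover hℓ, x.range_vmap_cover.trans h.range_eq.symm⟩

lemma toClass_eq_iff (hℓ : 0 < ℓ) (h : IsSortedLift p r) (x : Marking Γ r ℓ d)
    (c : CoverClass ℓ g p d) :
    x.toClass hℓ h = c ↔ Nonempty (TropicalCover.Iso x.cover (Quotient.out c).1) :=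
  (Eq.congr_right (Quotient.out_eq c).symm).trans Quotient.eq

lemma card_fiber_mul_card_aut (hℓ : 0 < ℓ) (h : IsSortedLift p r) (c : CoverClass ℓ g p d) :
    Nat.card {x : Marking Γ r ℓ d // x.toClass hℓ h = c} *
      Nat.card (TropicalCover.Iso (Quotient.out c).1 (Quotient.out c).1) =
      Nat.card (Multigraph.Iso Γ.1 (Quotient.out c).1.C.toMultigraph) := by
  classical
  have := h.finite_marking hℓ (Γ := Γ) (d := d)
  let _ := Fintype.ofFinite (Marking Γ r ℓ d)
  obtain ⟨-, hasDegree, range_eq⟩ := (Quotient.out c).2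
  rw [← Nat.card_eq_of_bijective _
      (bijective_graphIso hℓ h.coe_injective hasDegree (range_eq.trans h.range_eq)),
    Nat.card_sigma, Nat.card_eq_fintype_card, Fintype.card_subtype, ← smul_eq_mul,
    ← Finset.sum_const, Finset.sum_filter]
  refine Finset.sum_congr rfl fun x _ => ?_
  split_ifs with hx
  · exact ((x.toClass_eq_iff hℓ h c).1 hx).some.card_eq.symm
  · rw [x.toClass_eq_iff hℓ h c, not_nonempty_iff] at hx
    exact Nat.card_of_isEmpty.symm

end Marking

/-- The source of a cover, as a Feynman graph. -/
def Cover.source (π : Cover ℓ g p d) : FeynmanGraph g :=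
  ⟨π.1.C.toMultigraph, π.1.C.connected, π.1.C.trivalent, π.2.1⟩

theorem finite_coverClass (hℓ : 0 < ℓ) (h : IsSortedLift p r) (d : ℕ) :
    Finite (CoverClass ℓ g p d) := by
  have := finite_feynmanClass g
  have (γ : FeynmanClass g) := h.finite_marking hℓ (Γ := Quotient.out γ) (d := d)
  refine Finite.of_surjective (fun x : Σ γ : FeynmanClass g, Marking (Quotient.out γ) r ℓ d =>
    x.2.toClass hℓ h) fun c => ?_
  obtain ⟨-, hasDegree, range_eq⟩ := (Quotient.out c).2
  obtain ⟨ψ⟩ := (nonempty_iso_ref_iff Quotient.out_eq _ (Quotient.out c).source).2 rfl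
  obtain ⟨x, φ, -⟩ := Marking.exists_graphIso_eq hℓ h.coe_injective hasDegree
    (range_eq.trans h.range_eq) ψ
  exact ⟨⟨_, x⟩, (x.toClass_eq_iff hℓ h c).2 ⟨φ⟩⟩

lemma markingCount_eq_sum_mult (hℓ : 0 < ℓ) (h : IsSortedLift p r)
    [Fintype (CoverClass ℓ g p d)] :
    markingCount Γ r ℓ d = ∑ c : CoverClass ℓ g p d, (Quotient.out c).1.mult *
      Nat.card (Multigraph.Iso Γ.1 (Quotient.out c).1.C.toMultigraph) := by
  classical
  have := h.finite_marking hℓ (Γ := Γ) (d := d)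
  let _ := Fintype.ofFinite (Marking Γ r ℓ d)
  rw [markingCount_eq_finsum hℓ h, finsum_eq_sum_of_fintype,
    ← Finset.sum_fiberwise (s := Finset.univ) (g := fun x : Marking Γ r ℓ d => x.toClass hℓ h)]
  refine Finset.sum_congr rfl fun c _ => ?_
  have prod_weight_eq : ∀ x ∈ Finset.univ.filter fun x : Marking Γ r ℓ d => x.toClass hℓ h = c,
      ∏ e, (x.cover.weight e : ℚ) = ∏ e, ((Quotient.out c).1.weight e : ℚ) := fun x hx =>
    ((x.toClass_eq_iff hℓ h c).1 (Finset.mem_filter.1 hx).2).some.prod_weight_eq hℓ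
  have : Nonempty (TropicalCover.Iso (Quotient.out c).1 (Quotient.out c).1) := ⟨.refl _⟩
  have card_aut_ne_zero :
      (Nat.card (TropicalCover.Iso (Quotient.out c).1 (Quotient.out c).1) : ℚ) ≠ 0 :=
    Nat.cast_ne_zero.2 Nat.card_pos.ne'
  rw [Finset.sum_congr rfl prod_weight_eq, Finset.sum_const, nsmul_eq_mul,
    ← Marking.card_fiber_mul_card_aut hℓ h c, TropicalCover.mult, ← Fintype.card_subtype,
    ← Nat.card_eq_fintype_card, Nat.cast_mul]
  field_simp

lemma tropicalHurwitz_eq_sum [Fintype (FeynmanClass g)] (hℓ : 0 < ℓ) (h : IsSortedLift p r)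
    (href : ∀ c, (ref c).toClass = c) : tropicalHurwitz ℓ g p d =
      ∑ γ, markingCount (ref γ) r ℓ d / Nat.card (Multigraph.Iso (ref γ).1 (ref γ).1) := by
  have := finite_coverClass hℓ h d
  let _ := Fintype.ofFinite (CoverClass ℓ g p d)
  simp only [markingCount_eq_sum_mult hℓ h, Finset.sum_div]
  rw [tropicalHurwitz, finsum_eq_sum_of_fintype, Finset.sum_comm]
  refine Finset.sum_congr rfl fun c _ => ?_
  have sum_eq_one := sum_card_iso_ref_div href (Quotient.out c).source
  rw [Cover.source] at sum_eq_one
  simp only [mul_div_assoc, ← Finset.mul_sum, sum_eq_one, mul_one]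

theorem hasSum_tropicalHurwitz (hℓ : 0 < ℓ) (h : IsSortedLift p r)
    (href : ∀ c, (ref c).toClass = c) {τ : UpperHalfPlane}
    {y : ∀ c, VertexOrder (ref c).1 → (ref c).1.V → ℝ} (hy : ∀ c Ω, Admissible Ω τ (y c Ω)) :
    HasSum (fun d => (tropicalHurwitz ℓ g p d : ℂ) * expTwoPi τ ^ d)
      (∑ᶠ c, feynmanSum (ref c).1 (y c) τ *
        (1 / (Nat.card (Multigraph.Iso (ref c).1 (ref c).1) : ℂ))) := by
  have := finite_feynmanClass g
  let _ := Fintype.ofFinite (FeynmanClass g)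
  rw [finsum_eq_sum_of_fintype]
  refine (hasSum_sum fun c _ => (hasSum_markingCount hℓ h (hy c)).mul_right _).congr_fun
    fun d => ?_
  rw [tropicalHurwitz_eq_sum hℓ h href, Rat.cast_sum, Finset.sum_mul]
  refine Finset.sum_congr rfl fun c _ => ?_
  push_cast
  ring

lemma tropicalHurwitz_zero (hℓ : 0 < ℓ) (h : IsSortedLift p r) : tropicalHurwitz ℓ g p 0 = 0 := by
  have := finite_feynmanClass g
  let _ := Fintype.ofFinite (FeynmanClass g)
  rw [tropicalHurwitz_eq_sum hℓ h Quotient.out_eq]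
  exact Finset.sum_eq_zero fun c _ => by rw [markingCount_zero hℓ, zero_div]

end Hurwitz

end TropMirror

end

/-- For `g > 1`, a tropical elliptic curve of any length `ℓ`, pairwise distinct branch points `p`,
any choice `ref` of a representative of every isomorphism class of Feynman graphs, and any
admissible starting points `y`: the counts are finite, and the generating series of the tropical
Hurwitz numbers converges to the weighted sum of the Feynman integrals. -/
theorem mainTheorem2 (g : ℕ) (hg : 1 < g) (ℓ : ℝ) (hℓ : 0 < ℓ)
    (p : Fin (2 * g - 2) → AddCircle ℓ) (hp : Function.Injective p)
    (ref : TropMirror.FeynmanClass g → TropMirror.FeynmanGraph g)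
    (href : ∀ c, Quotient.mk _ (ref c) = c)
    (τ : UpperHalfPlane)
    (y : ∀ c : TropMirror.FeynmanClass g,
      TropMirror.VertexOrder (ref c).1 → (ref c).1.V → ℝ)
    (hy : ∀ c Ω, TropMirror.Admissible Ω τ (y c Ω)) :
    (∀ d, Finite (TropMirror.CoverClass ℓ g p d)) ∧ Finite (TropMirror.FeynmanClass g) ∧
    HasSum
      (fun d : ℕ =>
        (TropMirror.tropicalHurwitz ℓ g p (d + 1) : ℂ) * TropMirror.nome τ ^ (2 * (d + 1)))
      (∑ᶠ c : TropMirror.FeynmanClass g,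
        TropMirror.feynmanSum (ref c).1 (y c) τ *
          (1 / (Nat.card (TropMirror.Multigraph.Iso (ref c).1 (ref c).1) : ℂ))) := by
  obtain ⟨r, hr⟩ := TropMirror.exists_isSortedLift hℓ hp
  refine ⟨TropMirror.finite_coverClass hℓ hr, TropMirror.finite_feynmanClass g, ?_⟩
  have hasSum := TropMirror.hasSum_tropicalHurwitz hℓ hr href hy
  rw [← hasSum_nat_add_iff' 1] at hasSum
  simpa [TropMirror.tropicalHurwitz_zero hℓ hr, pow_mul, TropMirror.nome_sq] using hasSum
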